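/- Let $k$ be a field, let $H=\langle 9,10,11,12,15\rangle\subseteq\mathbb N$ be the numerical semigroup generated by $9,10,11,12,15$, and let $R=k[\![H]\!]=k[\![t^9,t^{10},t^{11},t^{12},t^{15}]\!]$ be its numerical semigroup ring, that is, the subring of $k[\![t]\!]$ of all power series whose exponents lie in $H$; its field of fractions is $k(\!(t)\!)$. For elements $f_1,\dots,f_n\in k(\!(t)\!)$ write $(f_1,\dots,f_n)$ for the $R$-submodule they generate, and $J:I=\{x\in k(\!(t)\!)\mid xI\subseteq J\}$. Recall that a finitely generated $R$-module $C$ is semidualizing if the homothety map $R\to\operatorname{Hom}_R(C,C)$, $r\mapsto(c\mapsto rc)$, is an isomorphism and $\operatorname{Ext}^i_R(C,C)=0$ for all $i\ge 1$; it is nontrivial if it is isomorphic neither to $R$ nor to a canonical module of $R$. A canonical module of a Cohen–Macaulay local ring is a maximal Cohen–Macaulay module of finite injective dimension and of type $1$. Then the following hold. 1. The $R$-submodules $K=(1,t,t^3,t^4)$ and $I=(1,t)$ of $k(\!(t)\!)$ are fractional ideals of $R$, and $K$ is a canonical module of the Cohen–Macaulay local ring $R$. 2. $K:I=(1,t^3)$,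 and the minimal numbers of generators of $I$, $K:I$ and $K$ over $R$ are $2$, $2$ and $4$, respectively. 3. $I$ is a nontrivial semidualizing $R$-module: the homothety map $R\to\operatorname{Hom}_R(I,I)$ is an isomorphism, $\operatorname{Ext}^i_R(I,I)=0$ for all $i\ge1$, and $I$ is isomorphic neither to $R$ nor to a canonical module of $R$. 4. The Hilbert–Samuel multiplicity of $R$ is $e(R)=9$. -/

import Mathlib

open scoped LaurentSeries nonZeroDivisors PowerSeries Nat
open CategoryTheory Abelian

universe u

noncomputable section

/-! ### Semidualizing modules and canonical modules -/

/-- A finitely generated `R`-module `C` is semidualizing if the homothety map `R → Hom_R(C, C)`,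
`r ↦ (c ↦ r c)`, is an isomorphism and `Ext_R^i(C, C) = 0` for all `i > 0`. -/
structure IsSemidualizing (R : Type u) [CommRing R] (C : Type u) [AddCommGroup C] [Module R C] :
    Prop where
  finite : Module.Finite R C
  homothety_bijective : Function.Bijective (LinearMap.lsmul R C : R →ₗ[R] (C →ₗ[R] C))
  ext_eq_zero : ∀ i : ℕ, 0 < i → Subsingleton (Ext (ModuleCat.of R C) (ModuleCat.of R C) i)

/-- A finitely generated module `M` over a local ring `(R, 𝔪)` is maximal Cohen-Macaulay if there
is an `M`-regular sequence in `𝔪` whose length is the Krull dimension of `R`. -/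
structure IsMaximalCohenMacaulay (R : Type u) [CommRing R] [IsLocalRing R]
    (M : Type u) [AddCommGroup M] [Module R M] : Prop where
  finite : Module.Finite R M
  exists_regular : ∃ rs : List R, (∀ r ∈ rs, r ∈ IsLocalRing.maximalIdeal R) ∧
    RingTheory.Sequence.IsRegular M rs ∧ ringKrullDim R = (rs.length : ℕ)

/-- `K` is a canonical module of the Cohen-Macaulay (noetherian) local ring `(R, 𝔪)`: a maximal
Cohen-Macaulay module of finite injective dimension and of type one, i.e. `Ext_R^d(R/𝔪, K)` is a
one-dimensional vector space over `R/𝔪`, where `d = dim R`. -/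
structure IsCanonicalModule (R : Type u) [CommRing R] [IsLocalRing R]
    (K : Type u) [AddCommGroup K] [Module R K] : Prop where
  isNoetherianRing : IsNoetherianRing R
  ring_cohenMacaulay : IsMaximalCohenMacaulay R R
  maximalCohenMacaulay : IsMaximalCohenMacaulay R K
  finite_injectiveDimension : ∃ n : ℕ, HasInjectiveDimensionLE (ModuleCat.of R K) n
  type_eq_one : ∀ d : ℕ, ringKrullDim R = d →
    Nonempty (Ext (ModuleCat.of R (IsLocalRing.ResidueField R)) (ModuleCat.of R K) d ≃ₗ[R]
      IsLocalRing.ResidueField R)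

/-- A semidualizing module `C` is nontrivial if it is isomorphic neither to `R` nor to a
canonical module of `R`. -/
structure IsNontrivialSemidualizing (R : Type u) [CommRing R] [IsLocalRing R]
    (C : Type u) [AddCommGroup C] [Module R C] : Prop where
  isSemidualizing : IsSemidualizing R C
  not_iso_ring : ¬ Nonempty (C ≃ₗ[R] R)
  not_iso_canonical : ∀ (K : Type u) [AddCommGroup K] [Module R K],
    IsCanonicalModule R K → ¬ Nonempty (C ≃ₗ[R] K)

/-- The Hilbert-Samuel multiplicity of the local ring `(R, 𝔪)` of dimension `d` is `e`: all
`ℓ_R(R/𝔪^n)` are finite and `d! ℓ_R(R/𝔪^n) / n^d → e` as `n → ∞`. -/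
def HasMultiplicity (R : Type u) [CommRing R] [IsLocalRing R] (e : ℕ) : Prop :=
  (∀ n : ℕ, Module.length R (R ⧸ IsLocalRing.maximalIdeal R ^ n) ≠ ⊤) ∧
  ∃ d : ℕ, ringKrullDim R = d ∧
    Filter.Tendsto (fun n : ℕ => (d ! : ℝ) *
      ((Module.length R (R ⧸ IsLocalRing.maximalIdeal R ^ n)).toNat : ℝ) / (n : ℝ) ^ d)
      Filter.atTop (nhds (e : ℝ))

/-! ### Numerical semigroup rings -/

/-- `k⟦H⟧`: the subring of `k⟦t⟧` of the power series all of whose exponents lie in `H`. -/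
def semigroupRing (k : Type u) [Field k] (H : AddSubmonoid ℕ) : Subalgebra k k⟦X⟧ where
  carrier := {f | ∀ n, PowerSeries.coeff n f ≠ 0 → n ∈ H}
  mul_mem' := by
    intro f g hf hg n hn
    rw [PowerSeries.coeff_mul] at hn
    obtain ⟨p, hp, hpn⟩ := Finset.exists_ne_zero_of_sum_ne_zero hn
    rw [← Finset.HasAntidiagonal.mem_antidiagonal.1 hp]
    exact H.add_mem (hf _ (left_ne_zero_of_mul hpn)) (hg _ (right_ne_zero_of_mul hpn))
  add_mem' := by
    intro f g hf hg n hn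
    by_cases h : PowerSeries.coeff n f = 0
    · exact hg n (by intro h'; apply hn; simp [h, h'])
    · exact hf n h
  algebraMap_mem' := by
    intro r n hn
    by_cases h : n = 0
    · exact h ▸ H.zero_mem
    · exfalso
      apply hn
      change PowerSeries.coeff n (PowerSeries.C r) = 0
      simp [PowerSeries.coeff_C, h]

theorem mem_semigroupRing {k : Type u} [Field k] {H : AddSubmonoid ℕ} {f : k⟦X⟧} :
    f ∈ semigroupRing k H ↔ ∀ n, PowerSeries.coeff n f ≠ 0 → n ∈ H := Iff.rfl

theorem inv_mem_semigroupRing {k : Type u} [Field k] {H : AddSubmonoid ℕ} {f : k⟦X⟧}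
    (hf : f ∈ semigroupRing k H) : f⁻¹ ∈ semigroupRing k H := by
  rw [mem_semigroupRing] at hf ⊢
  intro n
  induction n using Nat.strong_induction_on with
  | _ n ih =>
    intro hn
    rw [PowerSeries.coeff_inv] at hn
    split_ifs at hn with h0
    · exact h0 ▸ H.zero_mem
    · obtain ⟨p, hp, hpn⟩ := Finset.exists_ne_zero_of_sum_ne_zero (right_ne_zero_of_mul hn)
      split_ifs at hpn with hlt
      · rw [← Finset.HasAntidiagonal.mem_antidiagonal.1 hp]
        exact H.add_mem (hf _ (left_ne_zero_of_mul hpn)) (ih _ hlt (right_ne_zero_of_mul hpn))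
      · exact absurd rfl hpn

instance semigroupRing.isLocalRing (k : Type u) [Field k] (H : AddSubmonoid ℕ) :
    IsLocalRing (semigroupRing k H) := by
  have key : ∀ a : semigroupRing k H, PowerSeries.constantCoeff (a : k⟦X⟧) ≠ 0 → IsUnit a := by
    intro a ha
    refine IsUnit.of_mul_eq_one ⟨(a : k⟦X⟧)⁻¹, inv_mem_semigroupRing a.2⟩ ?_
    exact Subtype.ext (PowerSeries.mul_inv_cancel _ ha)
  refine IsLocalRing.of_isUnit_or_isUnit_one_sub_self fun a => ?_
  by_cases h : PowerSeries.constantCoeff (a : k⟦X⟧) = 0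
  · exact Or.inr (key _ (by simp [h]))
  · exact Or.inl (key _ h)

/-- If `H` contains all large integers, then `k⸨t⸩` is the field of fractions of `k⟦H⟧`. -/
theorem semigroupRing.isFractionRing (k : Type u) [Field k] (H : AddSubmonoid ℕ) (c : ℕ)
    (hc : ∀ n, c ≤ n → n ∈ H) : IsFractionRing (semigroupRing k H) k⸨X⸩ := by
  have hmem : ∀ g : k⟦X⟧, PowerSeries.X ^ c * g ∈ semigroupRing k H := by
    intro g n hn
    apply hc
    by_contra hlt
    apply hn
    rw [PowerSeries.coeff_X_pow_mul', if_neg hlt]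
  have hX : (PowerSeries.X : k⟦X⟧) ^ c ≠ 0 := pow_ne_zero _ PowerSeries.X_ne_zero
  have hA : ∀ a : semigroupRing k H,
      algebraMap (semigroupRing k H) k⸨X⸩ a = algebraMap k⟦X⟧ k⸨X⸩ (a : k⟦X⟧) := fun _ => rfl
  have hX' : algebraMap k⟦X⟧ k⸨X⸩ (PowerSeries.X ^ c) ≠ 0 := fun h =>
    hX (IsFractionRing.injective k⟦X⟧ k⸨X⸩ (by rw [h, map_zero]))
  have : FaithfulSMul (semigroupRing k H) k⸨X⸩ := by
    rw [faithfulSMul_iff_algebraMap_injective]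
    intro a b hab
    rw [hA, hA] at hab
    exact Subtype.ext (IsFractionRing.injective k⟦X⟧ k⸨X⸩ hab)
  refine IsFractionRing.of_field _ _ ?_
  intro z
  obtain ⟨x, y, hy, hxy⟩ := IsFractionRing.div_surjective (A := k⟦X⟧) z
  refine ⟨⟨_, hmem x⟩, ⟨_, hmem y⟩, ?_⟩
  rw [hA, hA, map_mul, map_mul, mul_div_mul_left _ _ hX', hxy]

/-- The numerical semigroup `⟨9, 10, 11, 12, 15⟩`. -/
def semigroupH : AddSubmonoid ℕ := AddSubmonoid.closure {9, 10, 11, 12, 15}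

theorem mem_semigroupH_of_le (n : ℕ) (hn : 18 ≤ n) : n ∈ semigroupH := by
  induction n using Nat.strong_induction_on with
  | _ n ih =>
    have g : ∀ a ∈ ({9, 10, 11, 12, 15} : Set ℕ), a ∈ semigroupH :=
      fun a ha => AddSubmonoid.subset_closure ha
    have h9 := g 9 (by simp)
    have h10 := g 10 (by simp)
    have h11 := g 11 (by simp)
    have h12 := g 12 (by simp)
    have h15 := g 15 (by simp)
    by_cases h : 27 ≤ n
    · have := semigroupH.add_mem (ih (n - 9) (by omega) (by omega)) h9
      rwa [Nat.sub_add_cancel (by omega)] at this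
    · push Not at h
      interval_cases n
      · exact semigroupH.add_mem h9 h9
      · exact semigroupH.add_mem h9 h10
      · exact semigroupH.add_mem h10 h10
      · exact semigroupH.add_mem h10 h11
      · exact semigroupH.add_mem h11 h11
      · exact semigroupH.add_mem h11 h12
      · exact semigroupH.add_mem h12 h12
      · exact semigroupH.add_mem h10 h15
      · exact semigroupH.add_mem h11 h15

/-- `R = k⟦H⟧ = k⟦t^9, t^10, t^11, t^12, t^15⟧`. -/
abbrev ringR (k : Type u) [Field k] : Subalgebra k k⟦X⟧ := semigroupRing k semigroupH

/-- The total ring of fractions of `R` is `k⸨t⸩`. -/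
instance ringR.isFractionRing (k : Type u) [Field k] : IsFractionRing (ringR k) k⸨X⸩ :=
  semigroupRing.isFractionRing k semigroupH 18 mem_semigroupH_of_le

/-- The `R`-submodule `(t^a : a ∈ s)` of `k⸨t⸩` generated by the monomials `t^a`, `a ∈ s`. -/
def monomialModule (k : Type u) [Field k] (s : Set ℕ) : Submodule (ringR k) k⸨X⸩ :=
  Submodule.span (ringR k) ((fun a : ℕ => ((PowerSeries.X ^ a : k⟦X⟧) : k⸨X⸩)) '' s)

/-- The fractional ideal `K = (1, t, t^3, t^4)` of `R`. -/
abbrev idealK (k : Type u) [Field k] : Submodule (ringR k) k⸨X⸩ := monomialModule k {0, 1, 3, 4}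

/-- The fractional ideal `I = (1, t)` of `R`. -/
abbrev idealI (k : Type u) [Field k] : Submodule (ringR k) k⸨X⸩ := monomialModule k {0, 1}

end

/-!
Write `Q = k⸨t⸩`. Every fractional ideal generated by monomials `t^a` consists of all Laurent
series whose exponents lie in a set of integers (`mem_monomialModule_iff`), so memberships, colons
and syzygies of such ideals reduce to statements about exponents: `R` has exponents
`0, 9–12, 15, ≥ 18`, `I = (1, t)` has `0, 1, 9–13, 15, 16, ≥ 18`, and `K = (1, t, t^3, t^4)` has
`0, 1, 3, 4, 9–16, ≥ 18`, that is, all `n` such that `17 - n` is not in `H`.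

**`K` is canonical.** `K` consists of the `x` with `coeff₁₇ (R x) = 0`
(`mem_idealK_iff_coeff_smul`), so `Q / K` is the space of those `k`-functionals on `R` that vanish
on all series of large order. Baer's criterion for `Q / K` then amounts to extending a linear
functional over the field `k` (`injective_quotient_idealK`). As `Q` is injective too,
`0 → K → Q → Q / K → 0` is an injective resolution of `K`. For any `C ⊆ Q` the group `Ext¹(R/𝔪, C)`
is the socle of `Q / C`. This socle is spanned by `t^17` for `C = K`. For `C = I` it contains the
independent classes of `t^14` and `t^17`, so that `I` is not canonical.

**`I` is semidualizing.** The first syzygy of `I` is `J = {x ∈ R | t x ∈ R} = t^9 (1, t, t²)`, and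
the first syzygy of `J` is isomorphic to `J ⊕ J`. Since `I : J = (1, t, t²)` is `I + t I`, every
homomorphism from these syzygies to `I` extends to the ambient free module, which gives
`Ext¹(I, I) = Ext¹(J, I) = 0`; dimension shifting along `J ⊕ J` does the rest
(`subsingleton_ext_of_syzygy`).

**Multiplicity.** `𝔪^n` is the ideal of all series in `R` of order at least `9 n` as soon as
`n ≥ 2` (`maximalIdeal_pow`), and the length of `R/𝔪^n` is the number of elements of `H` below
`9 n`, which is `9 n - 12`.
-/

noncomputable section

/-! ### Dimension shifting for `Ext` of modules -/

section Ext

variable {R : Type u} [CommRing R]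

/-- A short exact sequence of modules, as a short complex in the category of modules. -/
abbrev moduleShortComplex {A B C : Type u} [AddCommGroup A] [Module R A] [AddCommGroup B]
    [Module R B] [AddCommGroup C] [Module R C] (f : A →ₗ[R] B) (g : B →ₗ[R] C)
    (hfg : Function.Exact f g) : ShortComplex (ModuleCat.{u} R) :=
  ShortComplex.mk (ModuleCat.ofHom f) (ModuleCat.ofHom g)
    (by ext x; exact hfg.apply_apply_eq_zero x)

theorem moduleShortComplex_shortExact {A B C : Type u} [AddCommGroup A] [Module R A]
    [AddCommGroup B] [Module R B] [AddCommGroup C] [Module R C] {f : A →ₗ[R] B} {g : B →ₗ[R] C}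
    (hf : Function.Injective f) (hfg : Function.Exact f g) (hg : Function.Surjective g) :
    (moduleShortComplex f g hfg).ShortExact where
  exact := (ShortComplex.moduleCat_exact_iff _).mpr fun x hx => (hfg x).mp hx
  mono_f := (ModuleCat.mono_iff_injective _).mpr hf
  epi_g := (ModuleCat.epi_iff_surjective _).mpr hg

variable {N P M X : Type u} [AddCommGroup N] [Module R N] [AddCommGroup P] [Module R P]
  [AddCommGroup M] [Module R M] [AddCommGroup X] [Module R X]

theorem subsingleton_ext_one_of_forall_exists_extension [Module.Projective R P]
    {f : N →ₗ[R] P} {g : P →ₗ[R] M}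
    (hf : Function.Injective f) (hfg : Function.Exact f g) (hg : Function.Surjective g)
    (hext : ∀ α : N →ₗ[R] X, ∃ β : P →ₗ[R] X, β ∘ₗ f = α) :
    Subsingleton (Ext (ModuleCat.of R M) (ModuleCat.of R X) 1) := by
  have hS := moduleShortComplex_shortExact hf hfg hg
  have : Projective (moduleShortComplex f g hfg).X₂ :=
    inferInstanceAs (Projective (ModuleCat.of R P))
  refine subsingleton_of_forall_eq 0 fun x => ?_
  obtain ⟨y, rfl⟩ := Ext.contravariant_sequence_exact₃ hS _ x (Ext.eq_zero_of_projective _)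
    (add_comm 1 0)
  obtain ⟨α, rfl⟩ := Ext.homEquiv₀.symm.surjective y
  obtain ⟨β, hβ⟩ := hext α.hom
  have hα : α = (moduleShortComplex f g hfg).f ≫ ModuleCat.ofHom β := by
    ext1
    exact hβ.symm
  rw [hα, Ext.homEquiv₀_symm_apply, ← Ext.mk₀_comp_mk₀, hS.extClass_comp_assoc]

theorem subsingleton_ext_succ_of_kernel [Module.Projective R P]
    {f : N →ₗ[R] P} {g : P →ₗ[R] M}
    (hf : Function.Injective f) (hfg : Function.Exact f g) (hg : Function.Surjective g) (n : ℕ)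
    (h : Subsingleton (Ext (ModuleCat.of R N) (ModuleCat.of R X) (n + 1))) :
    Subsingleton (Ext (ModuleCat.of R M) (ModuleCat.of R X) (n + 2)) := by
  have hS := moduleShortComplex_shortExact hf hfg hg
  have : Projective (moduleShortComplex f g hfg).X₂ :=
    inferInstanceAs (Projective (ModuleCat.of R P))
  refine subsingleton_of_forall_eq 0 fun x => ?_
  obtain ⟨y, rfl⟩ := Ext.contravariant_sequence_exact₃ hS _ x (Ext.eq_zero_of_projective _)
    (add_comm 1 (n + 1))
  rw [@Subsingleton.elim _ h y 0, Ext.comp_zero]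

theorem subsingleton_ext_prod (n : ℕ)
    (hN : Subsingleton (Ext (ModuleCat.of R N) (ModuleCat.of R X) n))
    (hM : Subsingleton (Ext (ModuleCat.of R M) (ModuleCat.of R X) n)) :
    Subsingleton (Ext (ModuleCat.of R (N × M)) (ModuleCat.of R X) n) := by
  have hS := moduleShortComplex_shortExact (R := R) (LinearMap.inl_injective (M := N) (M₂ := M))
    (.inl_snd) LinearMap.snd_surjective
  refine subsingleton_of_forall_eq 0 fun x => ?_
  obtain ⟨y, rfl⟩ := Ext.contravariant_sequence_exact₂ hS _ x (@Subsingleton.elim _ hN _ _)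
  rw [@Subsingleton.elim _ hM y 0, Ext.comp_zero]

/-- For a submodule `C` of an injective module `Q` and a module `T` with `Hom(T, Q) = 0`, the
connecting homomorphism `Hom(T, Q / C) → Ext¹(T, C)` is an isomorphism. -/
theorem nonempty_ext_one_linearEquiv_hom_quotient {T C Q : Type u} [AddCommGroup T] [Module R T]
    [AddCommGroup C] [Module R C] [AddCommGroup Q] [Module R Q] (hQ : Module.Injective R Q)
    (hT : ∀ α : T →ₗ[R] Q, α = 0) (f : C →ₗ[R] Q) (hf : Function.Injective f) :
    Nonempty (Ext (ModuleCat.of R T) (ModuleCat.of R C) 1 ≃ₗ[R]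
      (T →ₗ[R] Q ⧸ LinearMap.range f)) := by
  have hS := moduleShortComplex_shortExact hf (LinearMap.exact_map_mkQ_range f)
    (Submodule.mkQ_surjective _)
  have : Injective (moduleShortComplex f _ (LinearMap.exact_map_mkQ_range f)).X₂ :=
    Module.injective_object_of_injective_module R Q
  refine ⟨(LinearEquiv.ofBijective
    ((Ext.postcompOfLinear hS.extClass R (ModuleCat.of R T) (zero_add 1)) ∘ₗ
      (Ext.linearEquiv₀ (R := R)).symm.toLinearMap ∘ₗ
      (ModuleCat.homLinearEquiv (S := R)).symm.toLinearMap) ⟨?_, ?_⟩).symm⟩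
  · rw [← LinearMap.ker_eq_bot, LinearMap.ker_eq_bot']
    intro α hα
    obtain ⟨x, hx⟩ := Ext.covariant_sequence_exact₃ _ hS (Ext.mk₀ (ModuleCat.ofHom α))
      (zero_add 1) hα
    obtain ⟨x, rfl⟩ := Ext.homEquiv₀.symm.surjective x
    have hx0 : x = 0 := by
      ext1
      exact hT x.hom
    rw [hx0, Ext.homEquiv₀_symm_apply, Ext.mk₀_zero, Ext.zero_comp] at hx
    have := (Ext.mk₀_eq_zero_iff _).mp hx.symm
    exact congrArg ModuleCat.Hom.hom this
  · intro x
    obtain ⟨y, hy⟩ := Ext.covariant_sequence_exact₁ _ hS x (Ext.eq_zero_of_injective _)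
      (zero_add 1)
    obtain ⟨y, rfl⟩ := Ext.homEquiv₀.symm.surjective y
    exact ⟨y.hom, hy⟩

theorem hasInjectiveDimensionLE_one_of_injective {Q : Type u} [AddCommGroup Q] [Module R Q]
    (C : Submodule R Q) (hQ : Module.Injective R Q) (hC : Module.Injective R (Q ⧸ C)) :
    HasInjectiveDimensionLE (ModuleCat.of R C) 1 := by
  have hS := moduleShortComplex_shortExact C.injective_subtype
    (LinearMap.exact_subtype_mkQ C) C.mkQ_surjective
  refine hS.hasInjectiveDimensionLT_X₁ 1 ?_ ?_
  · have := Module.injective_object_of_injective_module R (Q ⧸ C)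
    exact inferInstanceAs (HasInjectiveDimensionLT (ModuleCat.of R (Q ⧸ C)) 1)
  · have := Module.injective_object_of_injective_module R Q
    exact inferInstanceAs (HasInjectiveDimensionLT (ModuleCat.of R Q) (1 + 1))

end Ext

/-! ### Monomial fractional ideals and their exponent sets -/

theorem mem_semigroupH_iff (n : ℕ) :
    n ∈ semigroupH ↔ n = 0 ∨ (9 ≤ n ∧ n ≤ 12) ∨ n = 15 ∨ 18 ≤ n := by
  constructor
  · intro h
    induction h using AddSubmonoid.closure_induction with
    | mem x hx =>
      simp only [Set.mem_insert_iff, Set.mem_singleton_iff] at hx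
      omega
    | zero => omega
    | add x y _ _ hx hy => omega
  · rintro (rfl | h | rfl | h)
    · exact zero_mem _
    · apply AddSubmonoid.subset_closure
      simp only [Set.mem_insert_iff, Set.mem_singleton_iff]
      omega
    · exact AddSubmonoid.subset_closure (by simp)
    · exact mem_semigroupH_of_le n h

/-- The semigroup `⟨9, 10, 11, 12, 15⟩` as a set of integers. -/
def exponentSet : Set ℤ := {n | n = 0 ∨ (9 ≤ n ∧ n ≤ 12) ∨ n = 15 ∨ 18 ≤ n}

theorem mem_exponentSet {n : ℤ} :
    n ∈ exponentSet ↔ n = 0 ∨ (9 ≤ n ∧ n ≤ 12) ∨ n = 15 ∨ 18 ≤ n := Iff.rfl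

theorem natCast_mem_exponentSet {n : ℕ} : (n : ℤ) ∈ exponentSet ↔ n ∈ semigroupH := by
  rw [mem_semigroupH_iff, mem_exponentSet]
  omega

variable {k : Type u} [Field k]

/-- The Laurent monomial `t^n`. -/
def tpow (k : Type u) [Field k] (n : ℤ) : k⸨X⸩ := HahnSeries.single n 1

theorem tpow_add (m n : ℤ) : tpow k (m + n) = tpow k m * tpow k n := by
  simp [tpow, HahnSeries.single_mul_single]

theorem tpow_zero : tpow k 0 = 1 := rfl

theorem tpow_ne_zero (n : ℤ) : tpow k n ≠ 0 := by simp [tpow]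

theorem coe_X_pow (a : ℕ) : ((PowerSeries.X ^ a : k⟦X⟧) : k⸨X⸩) = tpow k a := by
  simp [tpow]

theorem coeff_tpow_mul (a n : ℤ) (f : k⸨X⸩) : (tpow k a * f).coeff n = f.coeff (n - a) := by
  have := HahnSeries.coeff_single_mul_add (r := (1 : k)) (x := f) (a := n - a) (b := a)
  rwa [one_mul, sub_add_cancel] at this

theorem coeff_single_mul' (a n : ℤ) (c : k) (f : k⸨X⸩) :
    (HahnSeries.single a c * f).coeff n = c * f.coeff (n - a) := by
  have := HahnSeries.coeff_single_mul_add (r := c) (x := f) (a := n - a) (b := a)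
  rwa [sub_add_cancel] at this

theorem support_tpow_mul_subset_iff {a : ℤ} {f : k⸨X⸩} {S : Set ℤ} :
    (tpow k a * f).support ⊆ S ↔ ∀ n, f.coeff n ≠ 0 → n + a ∈ S := by
  constructor
  · intro h n hn
    refine h ?_
    rw [HahnSeries.mem_support, coeff_tpow_mul, add_sub_cancel_right]
    exact hn
  · intro h n hn
    rw [HahnSeries.mem_support, coeff_tpow_mul] at hn
    simpa using h _ hn

theorem exists_coe_powerSeries_eq {f : k⸨X⸩} (hf : ∀ n, f.coeff n ≠ 0 → 0 ≤ n) :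
    ∃ g : k⟦X⟧, (g : k⸨X⸩) = f := by
  refine ⟨PowerSeries.mk fun n => f.coeff n, ?_⟩
  ext n
  rw [PowerSeries.coeff_coe]
  split_ifs with h
  · by_contra h'
    exact absurd (hf n (fun h0 => h' h0.symm)) (by omega)
  · rw [PowerSeries.coeff_mk, Int.natAbs_of_nonneg (by omega)]

theorem algebraMap_eq_coe (r : ringR k) : algebraMap (ringR k) k⸨X⸩ r = ((r : k⟦X⟧) : k⸨X⸩) := rfl

theorem coeff_algebraMap_natCast (r : ringR k) (n : ℕ) :
    (algebraMap (ringR k) k⸨X⸩ r).coeff n = PowerSeries.coeff n (r : k⟦X⟧) := by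
  rw [algebraMap_eq_coe, LaurentSeries.coeff_coe_powerSeries]

theorem support_algebraMap_subset (r : ringR k) :
    (algebraMap (ringR k) k⸨X⸩ r).support ⊆ exponentSet := by
  intro n hn
  rw [HahnSeries.mem_support, algebraMap_eq_coe, PowerSeries.coeff_coe] at hn
  split_ifs at hn with h
  · exact absurd rfl hn
  · obtain ⟨m, rfl⟩ := Int.eq_ofNat_of_zero_le (not_lt.mp h)
    exact natCast_mem_exponentSet.mpr (r.2 m hn)

theorem exists_algebraMap_eq_iff {f : k⸨X⸩} :
    (∃ r : ringR k, algebraMap (ringR k) k⸨X⸩ r = f) ↔ f.support ⊆ exponentSet := by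
  constructor
  · rintro ⟨r, rfl⟩
    exact support_algebraMap_subset r
  · intro hf
    obtain ⟨g, rfl⟩ := exists_coe_powerSeries_eq (f := f) fun n hn => by
      have := mem_exponentSet.mp (hf hn)
      omega
    refine ⟨⟨g, fun n hn => natCast_mem_exponentSet.mp (hf ?_)⟩, rfl⟩
    rwa [HahnSeries.mem_support, LaurentSeries.coeff_coe_powerSeries]

theorem support_single_subset {n : ℤ} {c : k} {S : Set ℤ} (h : n ∈ S) :
    (HahnSeries.single n c : k⸨X⸩).support ⊆ S :=
  HahnSeries.support_single_subset.trans (Set.singleton_subset_iff.mpr h)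

/-- The monomial `t^n`, for `n ∈ H`, lifts to `R`. -/
theorem exists_algebraMap_eq_tpow {n : ℤ} (hn : n ∈ exponentSet) :
    ∃ r : ringR k, algebraMap (ringR k) k⸨X⸩ r = tpow k n :=
  exists_algebraMap_eq_iff.mpr (support_single_subset hn)

theorem support_smul_subset {S : Set ℤ} (hS : ∀ s ∈ S, ∀ h ∈ exponentSet, h + s ∈ S)
    (r : ringR k) {f : k⸨X⸩} (hf : f.support ⊆ S) : (r • f).support ⊆ S := by
  rw [Algebra.smul_def]
  refine HahnSeries.support_mul_subset.trans ?_
  rintro _ ⟨a, ha, b, hb, rfl⟩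
  exact hS _ (hf hb) _ (support_algebraMap_subset r ha)

/-- The fractional ideal generated by monomials `t^a`, `a ∈ s`, consists of all Laurent series
with exponents in `s + H`. -/
theorem mem_monomialModule_iff {s : Finset ℕ} {f : k⸨X⸩} :
    f ∈ monomialModule k (s : Set ℕ) ↔
      ∀ n, f.coeff n ≠ 0 → ∃ a ∈ s, n - (a : ℤ) ∈ exponentSet := by
  constructor
  · intro hf
    change f.support ⊆ {n : ℤ | ∃ a ∈ s, n - (a : ℤ) ∈ exponentSet}
    induction hf using Submodule.span_induction with
    | mem x hx =>
      obtain ⟨a, ha, rfl⟩ := hx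
      change ((PowerSeries.X ^ a : k⟦X⟧) : k⸨X⸩).support ⊆ _
      rw [coe_X_pow]
      exact support_single_subset ⟨a, ha, by simp [mem_exponentSet]⟩
    | zero => simp
    | add x y _ _ hx hy => exact (HahnSeries.support_add_subset _ _).trans (Set.union_subset hx hy)
    | smul r x _ hx =>
      refine support_smul_subset ?_ r hx
      rintro n ⟨a, ha, hn⟩ h hh
      refine ⟨a, ha, ?_⟩
      rw [mem_exponentSet] at hn hh ⊢
      omega
  · induction s using Finset.induction_on generalizing f with
    | empty =>
      intro h
      have : f = 0 := by
        ext n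
        by_contra hn
        simpa using h n hn
      rw [this]
      exact zero_mem _
    | insert a s _ ih =>
      intro h
      classical
      -- Split off the part of `f` whose exponents lie in `a + H`; the rest lies in `s + H`.
      let g : k⸨X⸩ := HahnSeries.mk (fun n => if n - (a : ℤ) ∈ exponentSet then f.coeff n else 0)
        (f.isPWO_support.mono fun n hn => by
          simp only [Function.mem_support] at hn
          by_contra h0
          rw [HahnSeries.mem_support, not_not] at h0
          simp [h0] at hn)
      have hg : ∀ n, g.coeff n = if n - (a : ℤ) ∈ exponentSet then f.coeff n else 0 :=
        fun _ => rfl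
      rw [show f = g + (f - g) by abel]
      refine add_mem ?_ (Submodule.span_mono (Set.image_mono (by simp)) (ih fun n hn => ?_))
      · have h1 : (tpow k (-a) * g).support ⊆ exponentSet := by
          rw [support_tpow_mul_subset_iff]
          intro n hn
          rw [hg] at hn
          split_ifs at hn with h'
          · exact h'
          · exact absurd rfl hn
        obtain ⟨r, hr⟩ := exists_algebraMap_eq_iff.mpr h1
        have : g = r • tpow k a := by
          rw [Algebra.smul_def, hr, mul_right_comm, ← tpow_add, neg_add_cancel, tpow_zero, one_mul]
        rw [this]
        exact Submodule.smul_mem _ _ (Submodule.subset_span ⟨a, by simp, coe_X_pow a⟩)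
      · rw [HahnSeries.coeff_sub, hg] at hn
        split_ifs at hn with h'
        · simp at hn
        · rw [sub_zero] at hn
          obtain ⟨b, hb, hb'⟩ := h n hn
          rcases Finset.mem_insert.mp hb with rfl | hb
          · exact absurd hb' h'
          · exact ⟨b, hb, hb'⟩

theorem mem_idealI_iff {f : k⸨X⸩} : f ∈ idealI k ↔
    ∀ n, f.coeff n ≠ 0 → n = 0 ∨ n = 1 ∨ (9 ≤ n ∧ n ≤ 13) ∨ n = 15 ∨ n = 16 ∨ 18 ≤ n := by
  have := mem_monomialModule_iff (s := {0, 1}) (f := f)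
  simp only [Finset.coe_insert, Finset.coe_singleton] at this
  rw [this]
  refine forall₂_congr fun n _ => ?_
  simp [mem_exponentSet]
  omega

theorem mem_idealK_iff {f : k⸨X⸩} : f ∈ idealK k ↔
    ∀ n, f.coeff n ≠ 0 → n = 0 ∨ n = 1 ∨ n = 3 ∨ n = 4 ∨ (9 ≤ n ∧ n ≤ 16) ∨ 18 ≤ n := by
  have := mem_monomialModule_iff (s := {0, 1, 3, 4}) (f := f)
  simp only [Finset.coe_insert, Finset.coe_singleton] at this
  rw [this]
  refine forall₂_congr fun n _ => ?_
  simp [mem_exponentSet]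
  omega

theorem mem_monomialModule_zero_three_iff {f : k⸨X⸩} : f ∈ monomialModule k {0, 3} ↔
    ∀ n, f.coeff n ≠ 0 → n = 0 ∨ n = 3 ∨ (9 ≤ n ∧ n ≤ 15) ∨ 18 ≤ n := by
  have := mem_monomialModule_iff (s := {0, 3}) (f := f)
  simp only [Finset.coe_insert, Finset.coe_singleton] at this
  rw [this]
  refine forall₂_congr fun n _ => ?_
  simp [mem_exponentSet]
  omega

/-- The ideal `(t^9, t^10, t^11)`, isomorphic to the first syzygy of `I`. -/
abbrev idealJ (k : Type u) [Field k] : Submodule (ringR k) k⸨X⸩ := monomialModule k {9, 10, 11}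

theorem mem_idealJ_iff {f : k⸨X⸩} : f ∈ idealJ k ↔
    ∀ n, f.coeff n ≠ 0 → (9 ≤ n ∧ n ≤ 11) ∨ 18 ≤ n := by
  have := mem_monomialModule_iff (s := {9, 10, 11}) (f := f)
  simp only [Finset.coe_insert, Finset.coe_singleton] at this
  rw [this]
  refine forall₂_congr fun n _ => ?_
  simp [mem_exponentSet]
  omega

theorem mem_monomialModule_zero_one_two_iff {f : k⸨X⸩} : f ∈ monomialModule k {0, 1, 2} ↔
    ∀ n, f.coeff n ≠ 0 → (0 ≤ n ∧ n ≤ 2) ∨ 9 ≤ n := by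
  have := mem_monomialModule_iff (s := {0, 1, 2}) (f := f)
  simp only [Finset.coe_insert, Finset.coe_singleton] at this
  rw [this]
  refine forall₂_congr fun n _ => ?_
  simp [mem_exponentSet]
  omega

theorem mem_idealK_div_idealI_iff {f : k⸨X⸩} :
    f ∈ idealK k / idealI k ↔ f ∈ monomialModule k {0, 3} := by
  have hspan : f ∈ idealK k / idealI k ↔ f ∈ idealK k ∧ tpow k 1 * f ∈ idealK k := by
    rw [Submodule.mem_div_iff_forall_mul_mem]
    constructor
    · intro h
      refine ⟨?_, ?_⟩
      · simpa using h 1 (Submodule.subset_span ⟨0, by simp, by simp⟩)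
      · rw [mul_comm]
        exact h _ (Submodule.subset_span ⟨1, by simp, coe_X_pow 1⟩)
    · rintro ⟨h0, h1⟩ y hy
      induction hy using Submodule.span_induction with
      | mem x hx =>
        obtain ⟨a, ha, rfl⟩ := hx
        rcases ha with rfl | rfl
        · simpa using h0
        · rw [mul_comm]
          simpa only [coe_X_pow, Nat.cast_one] using h1
      | zero => simp
      | add x y _ _ hx hy => simpa [mul_add] using add_mem hx hy
      | smul r x _ hx => simpa using Submodule.smul_mem _ r hx
  rw [hspan, mem_idealK_iff, mem_idealK_iff, mem_monomialModule_zero_three_iff]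
  constructor
  · rintro ⟨h0, h1⟩ n hn
    have h0 := h0 n hn
    have h1 := h1 (n + 1) (by rwa [coeff_tpow_mul, add_sub_cancel_right])
    omega
  · intro h
    refine ⟨fun n hn => ?_, fun n hn => ?_⟩
    · have := h n hn
      omega
    · rw [coeff_tpow_mul] at hn
      have := h _ hn
      omega

theorem idealK_div_idealI : idealK k / idealI k = monomialModule k {0, 3} :=
  Submodule.ext fun _ => mem_idealK_div_idealI_iff

theorem isFractional_monomialModule (s : Finset ℕ) :
    IsFractional (nonZeroDivisors (ringR k)) (monomialModule k (s : Set ℕ)) :=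
  FractionalIdeal.isFractional_of_fg (Submodule.fg_span ((Finset.finite_toSet s).image _))

/-! ### Minimal numbers of generators -/

/-- If no generator `t^a` lies in the span of the others, the monomial generating set is minimal:
the coefficients at the exponents in `s` give a surjection onto `k^s` which is linear over
`R → k`. -/
theorem spanFinrank_monomialModule (s : Finset ℕ)
    (hs : ∀ a ∈ s, ∀ b ∈ s, ((a : ℤ) - b) ∈ exponentSet → a = b) :
    (monomialModule k (s : Set ℕ)).spanFinrank = s.card := by
  have hfg : (monomialModule k (s : Set ℕ)).FG :=
    Submodule.fg_span ((Finset.finite_toSet s).image _)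
  refine le_antisymm ?_ ?_
  · refine (Submodule.spanFinrank_span_le_ncard_of_finite
      ((Finset.finite_toSet s).image _)).trans ?_
    exact (Set.ncard_image_le (Finset.finite_toSet s)).trans (Set.ncard_coe_finset s).le
  · let c : k⸨X⸩ →ₗ[k] (s → k) :=
      { toFun f a := f.coeff (a : ℕ)
        map_add' _ _ := rfl
        map_smul' _ _ := rfl }
    have hc : ∀ f ∈ monomialModule k (s : Set ℕ), ∀ r : ringR k,
        c (r • f) = PowerSeries.constantCoeff (r : k⟦X⟧) • c f := by
      intro f hf r
      ext ⟨a, ha⟩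
      change (r • f).coeff a = PowerSeries.constantCoeff (r : k⟦X⟧) * f.coeff a
      have h0 : PowerSeries.constantCoeff (r : k⟦X⟧) =
          (algebraMap (ringR k) k⸨X⸩ r).coeff 0 := by
        rw [← PowerSeries.coeff_zero_eq_constantCoeff_apply]
        exact (coeff_algebraMap_natCast r 0).symm
      rw [Algebra.smul_def, HahnSeries.coeff_mul, h0]
      rw [Finset.sum_eq_single (0, (a : ℤ))]
      · rintro ⟨i, j⟩ hij hne
        exfalso
        rw [Finset.mem_antidiagonal] at hij
        obtain ⟨hi, hj, hadd⟩ := hij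
        obtain ⟨b, hb, hj'⟩ := mem_monomialModule_iff.mp hf j hj
        have hi' := support_algebraMap_subset r hi
        dsimp only at hadd hi'
        have hab : a = b := hs a ha b hb (by
          rw [mem_exponentSet] at *
          omega)
        apply hne
        rw [mem_exponentSet] at hi' hj'
        ext <;> dsimp only <;> omega
      · intro h
        rw [Finset.mem_antidiagonal] at h
        simp only [HahnSeries.mem_support, zero_add, and_true, not_and_or, not_not] at h
        rcases h with h | h <;> simp [h]
    set G := (monomialModule k (s : Set ℕ)).generators with hG
    have hGfin : G.Finite := hfg.finite_generators
    have hmem : ∀ f ∈ monomialModule k (s : Set ℕ), c f ∈ Submodule.span k (c '' G) := by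
      intro f hf
      have hf' := hf
      rw [← Submodule.span_generators (monomialModule k (s : Set ℕ))] at hf'
      induction hf' using Submodule.span_induction with
      | mem x hx => exact Submodule.subset_span ⟨x, hx, rfl⟩
      | zero => simp
      | add x y hx hy ihx ihy =>
        rw [Submodule.span_generators] at hx hy
        rw [map_add]
        exact add_mem (ihx hx) (ihy hy)
      | smul r x hx ih =>
        rw [Submodule.span_generators] at hx
        rw [hc x hx]
        exact Submodule.smul_mem _ _ (ih hx)
    have htop : Submodule.span k (c '' G) = ⊤ := by
      classical
      rw [eq_top_iff, ← (Pi.basisFun k s).span_eq, Submodule.span_le]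
      rintro _ ⟨a, rfl⟩
      have ha : c (tpow k (a : ℕ)) = Pi.basisFun k s a := by
        ext b
        change (HahnSeries.single ((a : ℕ) : ℤ) (1 : k)).coeff ((b : ℕ) : ℤ) = _
        rw [HahnSeries.coeff_single, Pi.basisFun_apply, Pi.single_apply]
        by_cases h : b = a
        · rw [if_pos h, if_pos (by rw [h])]
        · rw [if_neg h, if_neg (by rwa [Nat.cast_inj, ← Subtype.ext_iff])]
      rw [← ha]
      exact hmem _ (Submodule.subset_span ⟨a, a.2, coe_X_pow _⟩)
    have h1 : (Submodule.span k (c '' G)).spanFinrank = s.card := by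
      rw [htop, ← Module.finrank_eq_spanFinrank_of_free]
      simp
    rw [← h1, ← hfg.generators_ncard]
    exact (Submodule.spanFinrank_span_le_ncard_of_finite (hGfin.image _)).trans
      (Set.ncard_image_le hGfin)

/-! ### Noetherianity, dimension and depth of `R` -/

/-- All exponents of the Laurent series `f` are at least `N`; the zero series satisfies this for
every `N`. -/
def OrderGE (N : ℤ) (f : k⸨X⸩) : Prop := ∀ n, f.coeff n ≠ 0 → N ≤ n

theorem OrderGE.mul {M N : ℤ} {f g : k⸨X⸩} (hf : OrderGE M f) (hg : OrderGE N g) :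
    OrderGE (M + N) (f * g) := by
  intro n hn
  obtain ⟨a, ha, b, hb, rfl⟩ := HahnSeries.support_mul_subset hn
  exact add_le_add (hf a ha) (hg b hb)

theorem OrderGE.add {N : ℤ} {f g : k⸨X⸩} (hf : OrderGE N f) (hg : OrderGE N g) :
    OrderGE N (f + g) := by
  intro n hn
  rcases HahnSeries.support_add_subset _ _ hn with h | h
  exacts [hf n h, hg n h]

theorem orderGE_order (f : k⸨X⸩) : OrderGE f.order f := fun _ hn =>
  HahnSeries.order_le_of_coeff_ne_zero hn

theorem orderGE_tpow (n : ℤ) : OrderGE n (tpow k n) := fun m hm => by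
  by_contra h
  exact hm (HahnSeries.coeff_single_of_ne (by omega))

theorem OrderGE.exists_algebraMap_eq {f : k⸨X⸩} (hf : OrderGE 18 f) :
    ∃ r : ringR k, algebraMap (ringR k) k⸨X⸩ r = f :=
  exists_algebraMap_eq_iff.mpr fun n hn => by
    have := hf n hn
    rw [mem_exponentSet]
    omega

theorem algebraMap_ringR_injective : Function.Injective (algebraMap (ringR k) k⸨X⸩) :=
  IsFractionRing.injective (ringR k) k⸨X⸩

theorem smul_eq_zero_iff_ringR {r : ringR k} {x : k⸨X⸩} : r • x = 0 ↔ r = 0 ∨ x = 0 := by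
  rw [Algebra.smul_def, mul_eq_zero, map_eq_zero_iff _ algebraMap_ringR_injective]

/-- Every series of large order is a multiple in `R` of a given nonzero Laurent series: the
conductor of `R` in `k⟦t⟧` is `t^18 k⟦t⟧`. -/
theorem exists_forall_orderGE_exists_smul_eq {x : k⸨X⸩} (hx : x ≠ 0) (M : ℤ) :
    ∃ N : ℕ, ∀ y : k⸨X⸩, OrderGE N y →
      ∃ r : ringR k, OrderGE M (algebraMap (ringR k) k⸨X⸩ r) ∧ r • x = y := by
  refine ⟨(max M 18 - (x⁻¹).order).toNat, fun y hy => ?_⟩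
  have h := hy.mul (orderGE_order x⁻¹)
  obtain ⟨r, hr⟩ := OrderGE.exists_algebraMap_eq (f := y * x⁻¹) fun n hn => by
    have := h n hn
    omega
  refine ⟨r, ?_, ?_⟩
  · rw [hr]
    intro n hn
    have := h n hn
    omega
  · rw [Algebra.smul_def, hr, inv_mul_cancel_right₀ hx]

/-- The ideal of `R` of all power series of order at least `j`. -/
def orderIdeal (k : Type u) [Field k] (j : ℕ) : Ideal (ringR k) where
  carrier := {r | OrderGE j (algebraMap (ringR k) k⸨X⸩ r)}
  zero_mem' n hn := absurd (by simp) hn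
  add_mem' ha hb := by
    change OrderGE _ _
    rw [map_add]
    exact OrderGE.add ha hb
  smul_mem' r x hx := by
    change OrderGE _ _
    rw [smul_eq_mul, map_mul]
    have hr : OrderGE 0 (algebraMap (ringR k) k⸨X⸩ r) := fun n hn => by
      have := mem_exponentSet.mp (support_algebraMap_subset r hn)
      omega
    simpa using hr.mul hx

theorem mem_orderIdeal {j : ℕ} {r : ringR k} :
    r ∈ orderIdeal k j ↔ OrderGE j (algebraMap (ringR k) k⸨X⸩ r) := Iff.rfl

theorem isUnit_of_coeff_zero_ne_zero {r : ringR k}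
    (h : (algebraMap (ringR k) k⸨X⸩ r).coeff 0 ≠ 0) : IsUnit r := by
  refine IsUnit.of_mul_eq_one ⟨(r : k⟦X⟧)⁻¹, inv_mem_semigroupRing r.2⟩ ?_
  refine Subtype.ext (PowerSeries.mul_inv_cancel _ ?_)
  rw [← PowerSeries.coeff_zero_eq_constantCoeff_apply, ← coeff_algebraMap_natCast]
  exact h

theorem mem_maximalIdeal_iff_coeff_zero {r : ringR k} :
    r ∈ IsLocalRing.maximalIdeal (ringR k) ↔ (algebraMap (ringR k) k⸨X⸩ r).coeff 0 = 0 := by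
  rw [IsLocalRing.mem_maximalIdeal, mem_nonunits_iff]
  constructor
  · intro h
    by_contra h0
    exact h (isUnit_of_coeff_zero_ne_zero h0)
  · intro h hu
    have h1 : IsUnit (PowerSeries.constantCoeff (r : k⟦X⟧)) :=
      (hu.map (ringR k).val).map PowerSeries.constantCoeff
    rw [← PowerSeries.coeff_zero_eq_constantCoeff_apply, ← coeff_algebraMap_natCast,
      Nat.cast_zero, h] at h1
    exact not_isUnit_zero h1

theorem mem_maximalIdeal_iff_orderGE {r : ringR k} :
    r ∈ IsLocalRing.maximalIdeal (ringR k) ↔ OrderGE 9 (algebraMap (ringR k) k⸨X⸩ r) := by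
  rw [mem_maximalIdeal_iff_coeff_zero]
  constructor
  · intro h n hn
    have h1 := mem_exponentSet.mp (support_algebraMap_subset r hn)
    have h2 : n ≠ 0 := by
      rintro rfl
      exact hn h
    omega
  · intro h
    by_contra h0
    have := h 0 h0
    omega

theorem maximalIdeal_eq_orderIdeal :
    IsLocalRing.maximalIdeal (ringR k) = orderIdeal k 9 :=
  Ideal.ext fun _ => mem_maximalIdeal_iff_orderGE

theorem mem_map_algebra_linearMap {A : Ideal (ringR k)} {r : ringR k} :
    algebraMap (ringR k) k⸨X⸩ r ∈ Submodule.map (Algebra.linearMap (ringR k) k⸨X⸩) A ↔ r ∈ A := by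
  constructor
  · rintro ⟨s, hs, hsr⟩
    rwa [← algebraMap_ringR_injective hsr]
  · intro h
    exact ⟨r, h, rfl⟩

theorem map_maximalIdeal : Submodule.map (Algebra.linearMap (ringR k) k⸨X⸩)
    (IsLocalRing.maximalIdeal (ringR k)) = monomialModule k {9, 10, 11, 12, 15} := by
  have key : ∀ f : k⸨X⸩, f ∈ monomialModule k {9, 10, 11, 12, 15} ↔
      ∀ n, f.coeff n ≠ 0 → (9 ≤ n ∧ n ≤ 12) ∨ n = 15 ∨ 18 ≤ n := by
    intro f
    have := mem_monomialModule_iff (s := {9, 10, 11, 12, 15}) (f := f)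
    simp only [Finset.coe_insert, Finset.coe_singleton] at this
    rw [this]
    refine forall₂_congr fun n _ => ?_
    simp [mem_exponentSet]
    omega
  ext f
  rw [key]
  constructor
  · rintro ⟨r, hr, rfl⟩ n hn
    have h1 := mem_maximalIdeal_iff_orderGE.mp hr n hn
    have h2 := mem_exponentSet.mp (support_algebraMap_subset r hn)
    omega
  · intro h
    obtain ⟨r, rfl⟩ := (exists_algebraMap_eq_iff (f := f)).mpr fun n hn => by
      have := h n hn
      rw [mem_exponentSet]
      omega
    refine ⟨r, mem_maximalIdeal_iff_orderGE.mpr fun n hn => ?_, rfl⟩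
    have := h n hn
    omega

theorem maximalIdeal_fg : (IsLocalRing.maximalIdeal (ringR k)).FG := by
  refine Submodule.fg_of_fg_map_injective (Algebra.linearMap (ringR k) k⸨X⸩)
    algebraMap_ringR_injective ?_
  rw [map_maximalIdeal]
  exact Submodule.fg_span (Set.toFinite _)

theorem maximalIdeal_le_radical_span_singleton {x : ringR k} (hx : x ≠ 0) :
    IsLocalRing.maximalIdeal (ringR k) ≤ (Ideal.span {x}).radical := by
  intro r hr
  obtain ⟨N, hN⟩ := exists_forall_orderGE_exists_smul_eq
    (x := algebraMap (ringR k) k⸨X⸩ x) (fun h => hx (algebraMap_ringR_injective (by simpa using h)))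
    0
  have hpow : ∀ n : ℕ, OrderGE n (algebraMap (ringR k) k⸨X⸩ (r ^ n)) := by
    intro n
    induction n with
    | zero =>
      rw [pow_zero, map_one]
      exact orderGE_tpow 0
    | succ n ih =>
      rw [pow_succ, map_mul]
      intro m hm
      have := ih.mul (mem_maximalIdeal_iff_orderGE.mp hr) m hm
      push_cast
      omega
  obtain ⟨c, -, hc⟩ := hN _ (hpow N)
  refine ⟨N, Ideal.mem_span_singleton'.mpr ⟨c, algebraMap_ringR_injective ?_⟩⟩
  rw [← hc, map_mul, Algebra.smul_def]

theorem exists_mem_maximalIdeal_algebraMap_eq_tpow {n : ℤ} (hn : n ∈ exponentSet) (h0 : n ≠ 0) :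
    ∃ r ∈ IsLocalRing.maximalIdeal (ringR k), algebraMap (ringR k) k⸨X⸩ r = tpow k n := by
  obtain ⟨r, hr⟩ := exists_algebraMap_eq_tpow (k := k) hn
  refine ⟨r, mem_maximalIdeal_iff_coeff_zero.mpr ?_, hr⟩
  rw [hr]
  exact HahnSeries.coeff_single_of_ne h0.symm

theorem not_isField_ringR : ¬ IsField (ringR k) := by
  rw [IsLocalRing.isField_iff_maximalIdeal_eq]
  intro h
  obtain ⟨r, hr, h9⟩ := exists_mem_maximalIdeal_algebraMap_eq_tpow (k := k) (n := 9)
    (by simp [mem_exponentSet]) (by simp)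
  rw [h, Submodule.mem_bot] at hr
  rw [hr, map_zero] at h9
  exact tpow_ne_zero 9 h9.symm

theorem ringKrullDim_ringR : ringKrullDim (ringR k) = 1 :=
  ringKrullDim_eq_one_iff_of_isLocalRing_isDomain.mpr
    ⟨not_isField_ringR, fun _ hx => maximalIdeal_le_radical_span_singleton hx⟩

instance isNoetherianRing_ringR : IsNoetherianRing (ringR k) := by
  refine IsNoetherianRing.of_prime_ne_bot fun P hP hbot => ?_
  obtain ⟨x, hx, hx0⟩ := Submodule.exists_mem_ne_zero_of_ne_bot hbot
  have h : IsLocalRing.maximalIdeal (ringR k) ≤ P :=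
    (maximalIdeal_le_radical_span_singleton hx0).trans
      (hP.radical_le_iff.mpr ((Ideal.span_singleton_le_iff_mem _).mpr hx))
  rw [(IsLocalRing.le_maximalIdeal hP.ne_top).antisymm h]
  exact maximalIdeal_fg

/-- A nonzero finitely generated torsion-free `R`-module is maximal Cohen-Macaulay, since `t^9` is
regular on it. -/
theorem isMaximalCohenMacaulay_of_torsionFree (M : Type u) [AddCommGroup M] [Module (ringR k) M]
    [Module.Finite (ringR k) M] [Nontrivial M]
    (htf : ∀ (r : ringR k) (x : M), r • x = 0 → r = 0 ∨ x = 0) :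
    IsMaximalCohenMacaulay (ringR k) M where
  finite := inferInstance
  exists_regular := by
    obtain ⟨r, hr, h9⟩ := exists_mem_maximalIdeal_algebraMap_eq_tpow (k := k) (n := 9)
      (by simp [mem_exponentSet]) (by simp)
    have hr0 : r ≠ 0 := by
      rintro rfl
      rw [map_zero] at h9
      exact tpow_ne_zero 9 h9.symm
    refine ⟨[r], by simpa using hr, ?_, by simp [ringKrullDim_ringR]⟩
    refine RingTheory.Sequence.IsRegular.of_isWeaklyRegular_of_mem_maximalIdeal _
      (by simpa using hr) ?_
    rw [RingTheory.Sequence.isWeaklyRegular_singleton_iff, isSMulRegular_iff_right_eq_zero_of_smul]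
    exact fun x hx => (htf r x hx).resolve_left hr0

/-! ### Multiplicity -/

theorem orderIdeal_mul_le (i j : ℕ) : orderIdeal k i * orderIdeal k j ≤ orderIdeal k (i + j) := by
  rw [Ideal.mul_le]
  intro r hr s hs
  rw [mem_orderIdeal, map_mul, Nat.cast_add]
  exact hr.mul hs

theorem maximalIdeal_sq : IsLocalRing.maximalIdeal (ringR k) ^ 2 = orderIdeal k 18 := by
  refine le_antisymm ?_ fun f hf => ?_
  · rw [sq, maximalIdeal_eq_orderIdeal]
    exact orderIdeal_mul_le 9 9
  · -- The exponents `18, …, 26` are sums of two generators of `H`, and they generate all `n ≥ 18`.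
    have hspan : monomialModule k ((Finset.Icc 18 26 : Finset ℕ) : Set ℕ) ≤
        Submodule.map (Algebra.linearMap (ringR k) k⸨X⸩)
          (IsLocalRing.maximalIdeal (ringR k) ^ 2) := by
      refine Submodule.span_le.mpr ?_
      rintro _ ⟨a, ha, rfl⟩
      change ((PowerSeries.X ^ a : k⟦X⟧) : k⸨X⸩) ∈ _
      rw [coe_X_pow]
      rw [Finset.mem_coe, Finset.mem_Icc] at ha
      obtain ⟨i, j, hi, hj, hi0, hj0, hij⟩ : ∃ i j : ℤ, i ∈ exponentSet ∧ j ∈ exponentSet ∧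
          i ≠ 0 ∧ j ≠ 0 ∧ i + j = a := by
        simp only [mem_exponentSet]
        by_cases h : a ≤ 24
        · exact ⟨a / 2, a - a / 2, by omega, by omega, by omega, by omega, by omega⟩
        · exact ⟨a - 15, 15, by omega, by omega, by omega, by omega, by omega⟩
      obtain ⟨r, hr, hri⟩ := exists_mem_maximalIdeal_algebraMap_eq_tpow (k := k) hi hi0
      obtain ⟨s, hs, hsj⟩ := exists_mem_maximalIdeal_algebraMap_eq_tpow (k := k) hj hj0
      refine ⟨r * s, ?_, ?_⟩
      · rw [sq]
        exact Ideal.mul_mem_mul hr hs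
      · rw [Algebra.linearMap_apply, map_mul, hri, hsj, ← tpow_add, hij]
    refine mem_map_algebra_linearMap.mp (hspan (mem_monomialModule_iff.mpr fun n hn => ?_))
    have hn18 := hf n hn
    by_cases h1 : n ≤ 26
    · exact ⟨n.toNat, by rw [Finset.mem_Icc]; omega, by rw [mem_exponentSet]; omega⟩
    · by_cases h2 : n ≤ 35
      · exact ⟨(n - 9).toNat, by rw [Finset.mem_Icc]; omega, by rw [mem_exponentSet]; omega⟩
      · exact ⟨18, by rw [Finset.mem_Icc]; omega, by rw [mem_exponentSet]; omega⟩

theorem maximalIdeal_pow (n : ℕ) (hn : 2 ≤ n) :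
    IsLocalRing.maximalIdeal (ringR k) ^ n = orderIdeal k (9 * n) := by
  induction n, hn using Nat.le_induction with
  | base => exact maximalIdeal_sq
  | succ n hn ih =>
    refine le_antisymm ?_ fun f hf => ?_
    · rw [pow_succ, ih, maximalIdeal_eq_orderIdeal]
      exact orderIdeal_mul_le _ 9
    · obtain ⟨r, hr, h9⟩ := exists_mem_maximalIdeal_algebraMap_eq_tpow (k := k) (n := 9)
        (by simp [mem_exponentSet]) (by simp)
      have h := (orderGE_tpow (k := k) (-9)).mul hf
      obtain ⟨g, hg⟩ := OrderGE.exists_algebraMap_eq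
        (f := tpow k (-9) * algebraMap (ringR k) k⸨X⸩ f) fun m hm => by
          have := h m hm
          push_cast at this
          omega
      have hfg : f = g * r := algebraMap_ringR_injective (by
        rw [map_mul, hg, h9, mul_right_comm, ← tpow_add, neg_add_cancel, tpow_zero, one_mul])
      rw [hfg, pow_succ, ih]
      refine Ideal.mul_mem_mul ?_ hr
      rw [mem_orderIdeal, hg]
      intro m hm
      have := h m hm
      push_cast at this ⊢
      omega

theorem exists_algebraMap_eq_single {n : ℤ} (hn : n ∈ exponentSet) (c : k) :
    ∃ r : ringR k, algebraMap (ringR k) k⸨X⸩ r = HahnSeries.single n c :=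
  exists_algebraMap_eq_iff.mpr (support_single_subset hn)

theorem orderIdeal_succ_le (j : ℕ) : orderIdeal k (j + 1) ≤ orderIdeal k j := fun r hr n hn => by
  have := hr n hn
  push_cast at this
  omega

theorem mem_orderIdeal_succ_iff {j : ℕ} {r : ringR k} : r ∈ orderIdeal k (j + 1) ↔
    r ∈ orderIdeal k j ∧ (algebraMap (ringR k) k⸨X⸩ r).coeff j = 0 := by
  constructor
  · intro h
    refine ⟨orderIdeal_succ_le j h, ?_⟩
    by_contra h0
    have := h j h0
    push_cast at this
    omega
  · rintro ⟨h, h0⟩ n hn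
    have h1 := h n hn
    have h2 : n ≠ j := by
      rintro rfl
      exact hn h0
    push_cast
    omega

/-- A shortcut for instance search, which is slow to unfold `ringR k`. -/
instance quotientModule_ringR (A : Ideal (ringR k)) : Module (ringR k) (ringR k ⧸ A) :=
  Submodule.Quotient.module A

/-- Each exponent `j ∈ H` contributes one composition factor, spanned by the class of `t^j`. -/
theorem length_quotient_orderIdeal_succ {j : ℕ} (hj : j ∈ semigroupH) :
    Module.length (ringR k) (ringR k ⧸ orderIdeal k (j + 1)) =
      1 + Module.length (ringR k) (ringR k ⧸ orderIdeal k j) := by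
  obtain ⟨r, hr⟩ := exists_algebraMap_eq_tpow (k := k) (natCast_mem_exponentSet.mpr hj)
  have hker : ∀ s : ringR k, s * r ∈ orderIdeal k (j + 1) ↔
      s ∈ IsLocalRing.maximalIdeal (ringR k) := by
    intro s
    have hsr : s * r ∈ orderIdeal k j := Ideal.mul_mem_left _ _ (by
      rw [mem_orderIdeal, hr]
      exact orderGE_tpow _)
    rw [mem_orderIdeal_succ_iff, mem_maximalIdeal_iff_coeff_zero, map_mul, hr,
      mul_comm (algebraMap _ _ s), coeff_tpow_mul, sub_self]
    exact and_iff_right hsr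
  let f : (ringR k ⧸ IsLocalRing.maximalIdeal (ringR k)) →ₗ[ringR k]
      (ringR k ⧸ orderIdeal k (j + 1)) :=
    Submodule.liftQ _ ((orderIdeal k (j + 1)).mkQ ∘ₗ LinearMap.toSpanSingleton _ _ r) (by
      intro s hs
      exact (Submodule.Quotient.mk_eq_zero _).mpr ((hker s).mpr hs))
  have hf : ∀ s : ringR k, f (Submodule.Quotient.mk s) = Submodule.Quotient.mk (s * r) :=
    fun _ => rfl
  let g : (ringR k ⧸ orderIdeal k (j + 1)) →ₗ[ringR k] (ringR k ⧸ orderIdeal k j) :=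
    Submodule.factor (orderIdeal_succ_le j)
  have hg : ∀ s : ringR k, g (Submodule.Quotient.mk s) = Submodule.Quotient.mk s := fun _ => rfl
  have : IsSimpleModule (ringR k) (ringR k ⧸ IsLocalRing.maximalIdeal (ringR k)) :=
    isSimpleModule_iff_isCoatom.mpr (IsLocalRing.maximalIdeal.isMaximal (ringR k)).out
  rw [← Module.length_eq_one (ringR k) (ringR k ⧸ IsLocalRing.maximalIdeal (ringR k))]
  refine Module.length_eq_add_of_exact f g ?_ ?_ ?_
  · rw [← LinearMap.ker_eq_bot, LinearMap.ker_eq_bot']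
    intro x hx
    obtain ⟨s, rfl⟩ := Submodule.Quotient.mk_surjective _ x
    rw [hf, Submodule.Quotient.mk_eq_zero, hker] at hx
    exact (Submodule.Quotient.mk_eq_zero _).mpr hx
  · exact Submodule.factor_surjective _
  · intro x
    obtain ⟨s, rfl⟩ := Submodule.Quotient.mk_surjective _ x
    rw [hg, Submodule.Quotient.mk_eq_zero]
    constructor
    · intro hs
      obtain ⟨c, hc⟩ := exists_algebraMap_eq_single (k := k) (n := 0) (by simp [mem_exponentSet])
        ((algebraMap (ringR k) k⸨X⸩ s).coeff j)
      refine ⟨Submodule.Quotient.mk c, ?_⟩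
      rw [hf, eq_comm, Submodule.Quotient.eq, mem_orderIdeal_succ_iff]
      refine ⟨sub_mem hs (Ideal.mul_mem_left _ _ ?_), ?_⟩
      · rw [mem_orderIdeal, hr]
        exact orderGE_tpow _
      · rw [map_sub, map_mul, hc, hr, HahnSeries.coeff_sub, coeff_single_mul', sub_zero]
        simp [tpow]
    · rintro ⟨y, hy⟩
      obtain ⟨c, rfl⟩ := Submodule.Quotient.mk_surjective _ y
      rw [hf, Submodule.Quotient.eq] at hy
      have hcr : c * r ∈ orderIdeal k j := Ideal.mul_mem_left _ _ (by
        rw [mem_orderIdeal, hr]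
        exact orderGE_tpow _)
      exact (Submodule.sub_mem_iff_right _ hcr).mp (orderIdeal_succ_le j hy)

theorem orderIdeal_succ_of_notMem {j : ℕ} (hj : j ∉ semigroupH) :
    orderIdeal k (j + 1) = orderIdeal k j := by
  refine (orderIdeal_succ_le j).antisymm fun r hr => mem_orderIdeal_succ_iff.mpr ⟨hr, ?_⟩
  by_contra h0
  exact hj (natCast_mem_exponentSet.mp (support_algebraMap_subset r h0))

open Classical in
theorem length_quotient_orderIdeal (j : ℕ) :
    Module.length (ringR k) (ringR k ⧸ orderIdeal k j) =
      (Nat.count (· ∈ semigroupH) j : ℕ) := by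
  induction j with
  | zero =>
    have : orderIdeal k 0 = ⊤ := by
      refine (Ideal.eq_top_iff_one _).mpr ?_
      rw [mem_orderIdeal, map_one]
      exact orderGE_tpow 0
    rw [this, Nat.count_zero, Nat.cast_zero, Module.length_eq_zero_iff]
    exact Submodule.Quotient.subsingleton_iff.mpr rfl
  | succ j ih =>
    rw [Nat.count_succ]
    split_ifs with h
    · rw [length_quotient_orderIdeal_succ h, ih, Nat.cast_add, Nat.cast_one, add_comm]
    · rw [orderIdeal_succ_of_notMem h, ih, add_zero]

open Classical in
/-- Six elements of `H` lie below the conductor `18`. -/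
theorem count_semigroupH (j : ℕ) : Nat.count (· ∈ semigroupH) (18 + j) = 6 + j := by
  induction j with
  | zero =>
    simp only [mem_semigroupH_iff]
    simp [Nat.count_succ]
  | succ j ih =>
    rw [← add_assoc, Nat.count_succ, if_pos (mem_semigroupH_of_le _ (by omega)), ih, add_assoc]

theorem length_quotient_maximalIdeal_pow (n : ℕ) (hn : 2 ≤ n) :
    Module.length (ringR k) (ringR k ⧸ IsLocalRing.maximalIdeal (ringR k) ^ n) =
      ((9 * n - 12 : ℕ) : ℕ∞) := by
  classical
  obtain ⟨m, rfl⟩ := Nat.exists_eq_add_of_le hn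
  rw [maximalIdeal_pow _ hn, length_quotient_orderIdeal, show 9 * (2 + m) = 18 + 9 * m by ring,
    count_semigroupH]
  congr 1
  omega

theorem hasMultiplicity_ringR : HasMultiplicity (ringR k) 9 := by
  refine ⟨fun n => ?_, 1, ringKrullDim_ringR, ?_⟩
  · by_cases hn : 2 ≤ n
    · rw [length_quotient_maximalIdeal_pow n hn]
      exact ENat.natCast_ne_top _
    · refine ne_top_of_le_ne_top ?_ (Module.length_le_of_surjective
        (Submodule.factor (Ideal.pow_le_pow_right (I := IsLocalRing.maximalIdeal (ringR k))
          (show n ≤ 2 by omega))) (Submodule.factor_surjective _))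
      rw [length_quotient_maximalIdeal_pow 2 le_rfl]
      exact ENat.natCast_ne_top _
  · have hlim : Filter.Tendsto (fun n : ℕ => (9 : ℝ) - 12 / (n : ℝ)) Filter.atTop
        (nhds ((9 : ℕ) : ℝ)) := by
      simpa using (tendsto_const_nhds (x := (9 : ℝ))).sub
        (tendsto_const_div_atTop_nhds_zero_nat (12 : ℝ))
    refine hlim.congr' ?_
    filter_upwards [Filter.eventually_ge_atTop 2] with n hn
    rw [length_quotient_maximalIdeal_pow n hn, ENat.toNat_natCast, Nat.cast_sub (by omega)]
    have : (n : ℝ) ≠ 0 := by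
      rw [Nat.cast_ne_zero]
      omega
    simp
    field_simp

/-! ### The residue pairing and injectivity of `Q / K` -/

/-- `K` is the orthogonal complement of `R` under the residue pairing: it consists of the `x`
for which all products `r x`, `r ∈ R`, have vanishing coefficient at the Frobenius number `17`. -/
theorem mem_idealK_iff_coeff_smul {x : k⸨X⸩} :
    x ∈ idealK k ↔ ∀ r : ringR k, (r • x).coeff 17 = 0 := by
  constructor
  · intro hx r
    by_contra h
    have := mem_idealK_iff.mp (Submodule.smul_mem _ r hx) 17 h
    omega
  · intro h
    rw [mem_idealK_iff]
    intro n hn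
    by_contra hK
    obtain ⟨r, hr⟩ := exists_algebraMap_eq_tpow (k := k) (n := 17 - n) (by
      rw [mem_exponentSet]
      omega)
    apply hn
    rw [← h r, Algebra.smul_def, hr, coeff_tpow_mul]
    congr 1
    omega

/-- The fraction field `Q = k⸨t⸩` is injective over `R`, being torsion-free and divisible. -/
theorem injective_laurentSeries : Module.Injective (ringR k) k⸨X⸩ := by
  refine Module.Baer.injective fun A g => ?_
  by_cases hA : A = ⊥
  · refine ⟨0, fun x hx => ?_⟩
    subst hA
    obtain rfl := (Submodule.mem_bot _).mp hx
    exact (map_zero g).symm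
  · obtain ⟨a, ha, ha0⟩ := Submodule.exists_mem_ne_zero_of_ne_bot hA
    have ha0' : algebraMap (ringR k) k⸨X⸩ a ≠ 0 := fun h =>
      ha0 (algebraMap_ringR_injective (by rw [h, map_zero]))
    refine ⟨LinearMap.toSpanSingleton (ringR k) _ ((algebraMap (ringR k) k⸨X⸩ a)⁻¹ * g ⟨a, ha⟩),
      fun x hx => ?_⟩
    have h : a • g ⟨x, hx⟩ = x • g ⟨a, ha⟩ := by
      rw [← map_smul, ← map_smul]
      exact congrArg g (Subtype.ext (mul_comm a x))
    rw [Algebra.smul_def, Algebra.smul_def] at h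
    rw [LinearMap.toSpanSingleton_apply, Algebra.smul_def, mul_left_comm, ← h,
      inv_mul_cancel_left₀ ha0']

/-- The coefficient at the Frobenius number `17`, as a functional on `Q / K`. -/
def residueFunctional (k : Type u) [Field k] : (k⸨X⸩ ⧸ idealK k) →+ k :=
  QuotientAddGroup.lift (idealK k).toAddSubgroup
    { toFun f := f.coeff 17, map_zero' := rfl, map_add' _ _ := rfl } fun x hx => by
      simpa using mem_idealK_iff_coeff_smul.mp hx 1

theorem residueFunctional_mk (x : k⸨X⸩) :
    residueFunctional k (Submodule.Quotient.mk x) = x.coeff 17 := rfl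

/-- The residue pairing embeds `Q / K` into the `k`-dual of `R`. -/
theorem eq_of_forall_residueFunctional_smul_eq {v w : k⸨X⸩ ⧸ idealK k}
    (h : ∀ r : ringR k, residueFunctional k (r • v) = residueFunctional k (r • w)) : v = w := by
  obtain ⟨x, rfl⟩ := Submodule.Quotient.mk_surjective _ v
  obtain ⟨y, rfl⟩ := Submodule.Quotient.mk_surjective _ w
  rw [Submodule.Quotient.eq, mem_idealK_iff_coeff_smul]
  intro r
  rw [smul_sub, HahnSeries.coeff_sub, sub_eq_zero]
  exact h r

theorem algebraMap_smul_ringR (c : k) (f : k⸨X⸩) :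
    (algebraMap k (ringR k) c) • f = HahnSeries.single 0 c * f := by
  rw [Algebra.smul_def]
  congr 1
  rw [algebraMap_eq_coe]
  change HahnSeries.ofPowerSeries ℤ k (PowerSeries.C c) = _
  exact HahnSeries.ofPowerSeries_C c

theorem residueFunctional_algebraMap_smul (c : k) (v : k⸨X⸩ ⧸ idealK k) :
    residueFunctional k (algebraMap k (ringR k) c • v) = c * residueFunctional k v := by
  obtain ⟨x, rfl⟩ := Submodule.Quotient.mk_surjective _ v
  rw [← Submodule.Quotient.mk_smul, residueFunctional_mk, residueFunctional_mk,
    algebraMap_smul_ringR, coeff_single_mul', sub_zero]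

/-- A `k`-linear functional on `R` vanishing on all elements of large order is
`r ↦ coeff₁₇ (r x)` for some Laurent series `x`. -/
theorem exists_forall_coeff_smul_eq (b : ringR k →ₗ[k] k) (M : ℕ)
    (hb : ∀ r : ringR k, OrderGE M (algebraMap (ringR k) k⸨X⸩ r) → b r = 0) :
    ∃ x : k⸨X⸩, ∀ r : ringR k, (r • x).coeff 17 = b r := by
  classical
  have hmono : ∀ n : ℕ, ∃ s : ringR k, n ∈ semigroupH →
      algebraMap (ringR k) k⸨X⸩ s = tpow k n := fun n => by
    by_cases hn : n ∈ semigroupH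
    · obtain ⟨s, hs⟩ := exists_algebraMap_eq_tpow (k := k) (natCast_mem_exponentSet.mpr hn)
      exact ⟨s, fun _ => hs⟩
    · exact ⟨0, fun h => absurd h hn⟩
  choose m hm using hmono
  let F := (Finset.range M).filter (· ∈ semigroupH)
  refine ⟨∑ n ∈ F, HahnSeries.single (17 - (n : ℤ)) (b (m n)), fun r => ?_⟩
  -- Modulo elements of order at least `M`, the series `r` is a `k`-combination of monomials.
  have hr : b r = b (∑ n ∈ F, (algebraMap (ringR k) k⸨X⸩ r).coeff n • m n) := by
    rw [← sub_eq_zero, ← map_sub]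
    refine hb _ fun n hn => ?_
    by_contra hlt
    apply hn
    have hsm : ∀ (c : k) (s : ringR k), algebraMap (ringR k) k⸨X⸩ (c • s) =
        HahnSeries.single 0 c * algebraMap (ringR k) k⸨X⸩ s := fun c s => by
      rw [Algebra.smul_def, map_mul, ← algebraMap_smul_ringR, Algebra.smul_def]
    rw [map_sub, map_sum, HahnSeries.coeff_sub, HahnSeries.coeff_sum, sub_eq_zero]
    have hterm : ∀ i ∈ F, (algebraMap (ringR k) k⸨X⸩
        ((algebraMap (ringR k) k⸨X⸩ r).coeff i • m i)).coeff n =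
        if (i : ℤ) = n then (algebraMap (ringR k) k⸨X⸩ r).coeff i else 0 := fun i hi => by
      rw [hsm, hm i (Finset.mem_filter.mp hi).2, coeff_single_mul', sub_zero, tpow]
      split_ifs with h
      · rw [h, HahnSeries.coeff_single_same, mul_one]
      · rw [HahnSeries.coeff_single_of_ne (Ne.symm h), mul_zero]
    rw [Finset.sum_congr rfl hterm]
    by_cases h0 : (algebraMap (ringR k) k⸨X⸩ r).coeff n = 0
    · rw [h0, eq_comm]
      refine Finset.sum_eq_zero fun i _ => ?_
      split_ifs with h
      · rw [h, h0]
      · rfl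
    · have hn' := support_algebraMap_subset r h0
      obtain ⟨j, rfl⟩ : ∃ j : ℕ, n = j := ⟨n.toNat, by
        rw [mem_exponentSet] at hn'
        omega⟩
      rw [Finset.sum_eq_single j]
      · rw [if_pos rfl]
      · intro i _ hij
        rw [if_neg (by exact_mod_cast hij)]
      · intro hj
        refine absurd (Finset.mem_filter.mpr ⟨Finset.mem_range.mpr (by omega), ?_⟩) hj
        exact natCast_mem_exponentSet.mp hn'
  rw [hr, map_sum, Finset.smul_sum, HahnSeries.coeff_sum]
  refine Finset.sum_congr rfl fun n _ => ?_
  rw [Algebra.smul_def, mul_comm, coeff_single_mul', sub_sub_cancel, map_smul, smul_eq_mul,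
    mul_comm]

/-- Baer's criterion for `Q / K`: composing a map `A → Q / K` with the residue functional gives a
`k`-linear functional on the ideal `A` that vanishes on all elements of large order. Any
`k`-linear extension to `R` is represented by a Laurent series `x`, and `1 ↦ x` extends the given
map. -/
theorem injective_quotient_idealK : Module.Injective (ringR k) (k⸨X⸩ ⧸ idealK k) := by
  refine Module.Baer.injective fun A g => ?_
  by_cases hA : A = ⊥
  · refine ⟨0, fun x hx => ?_⟩
    subst hA
    obtain rfl := (Submodule.mem_bot _).mp hx
    exact (map_zero g).symm
  · obtain ⟨a, ha, ha0⟩ := Submodule.exists_mem_ne_zero_of_ne_bot hA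
    have ha0' : algebraMap (ringR k) k⸨X⸩ a ≠ 0 := fun h =>
      ha0 (algebraMap_ringR_injective (by rw [h, map_zero]))
    let b₀ : A.restrictScalars k →ₗ[k] k :=
      { toFun x := residueFunctional k (g ⟨x.1, x.2⟩)
        map_add' x y := (congrArg (residueFunctional k) (map_add g ⟨x.1, x.2⟩ ⟨y.1, y.2⟩)).trans
          (map_add _ _ _)
        map_smul' c x := by
          rw [RingHom.id_apply, smul_eq_mul, ← residueFunctional_algebraMap_smul, ← map_smul]
          congr 2
          exact Subtype.ext (Algebra.smul_def c (x : ringR k)) }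
    obtain ⟨b, hb⟩ := b₀.exists_extend
    have hbA : ∀ x : A, b x = residueFunctional k (g x) := fun x => LinearMap.congr_fun hb x
    obtain ⟨y, hy⟩ := Submodule.Quotient.mk_surjective _ (g ⟨a, ha⟩)
    obtain ⟨N, hN⟩ := exists_forall_orderGE_exists_smul_eq ha0' (18 - y.order)
    obtain ⟨x, hx⟩ := exists_forall_coeff_smul_eq b N fun r hr => by
      obtain ⟨c, hc, hca⟩ := hN _ hr
      have hrc : r = c * a := algebraMap_ringR_injective (by
        rw [← hca, map_mul, Algebra.smul_def])
      have h1 : b r = residueFunctional k (c • g ⟨a, ha⟩) := by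
        rw [← map_smul, ← hbA, hrc]
        rfl
      rw [h1, ← hy, ← Submodule.Quotient.mk_smul, residueFunctional_mk, Algebra.smul_def]
      by_contra h
      have := hc.mul (orderGE_order y) 17 h
      omega
    refine ⟨LinearMap.toSpanSingleton (ringR k) _ (Submodule.Quotient.mk x), fun z hz => ?_⟩
    refine eq_of_forall_residueFunctional_smul_eq fun r => ?_
    rw [LinearMap.toSpanSingleton_apply, ← map_smul, ← hbA, ← hx, smul_smul,
      ← Submodule.Quotient.mk_smul, residueFunctional_mk]
    rfl

/-! ### Socles and the type -/

section ResidueField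

variable {R : Type u} [CommRing R] [IsLocalRing R] {V : Type u} [AddCommGroup V] [Module R V]

theorem smul_residueField_eq_zero {r : R} (hr : r ∈ IsLocalRing.maximalIdeal R)
    (x : IsLocalRing.ResidueField R) : r • x = 0 := by
  rw [Algebra.smul_def, IsLocalRing.ResidueField.algebraMap_eq,
    (IsLocalRing.residue_eq_zero_iff r).mpr hr, zero_mul]

theorem hom_residueField_ext {a b : IsLocalRing.ResidueField R →ₗ[R] V} (h : a 1 = b 1) :
    a = b := by
  ext x
  obtain ⟨r, rfl⟩ := IsLocalRing.residue_surjective x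
  rw [← mul_one (IsLocalRing.residue R r), ← IsLocalRing.ResidueField.algebraMap_eq,
    ← Algebra.smul_def, map_smul, map_smul, h]

/-- A socle element is the value at `1` of a homomorphism from the residue field. -/
theorem exists_hom_residueField_apply_one {v : V}
    (hv : ∀ r ∈ IsLocalRing.maximalIdeal R, r • v = 0) :
    ∃ a : IsLocalRing.ResidueField R →ₗ[R] V, a 1 = v :=
  ⟨Submodule.liftQ (IsLocalRing.maximalIdeal R) (LinearMap.toSpanSingleton R V v) hv,
    one_smul R v⟩

/-- If the socle of `V` is generated by one nonzero element, then `Hom(R/𝔪, V) ≅ R/𝔪`. -/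
theorem nonempty_hom_residueField_linearEquiv {v : V} (hv0 : v ≠ 0)
    (hv : ∀ r ∈ IsLocalRing.maximalIdeal R, r • v = 0)
    (hspan : ∀ w : V, (∀ r ∈ IsLocalRing.maximalIdeal R, r • w = 0) → ∃ c : R, w = c • v) :
    Nonempty ((IsLocalRing.ResidueField R →ₗ[R] V) ≃ₗ[R] IsLocalRing.ResidueField R) := by
  obtain ⟨a, ha⟩ := exists_hom_residueField_apply_one hv
  let f : R →ₗ[R] (IsLocalRing.ResidueField R →ₗ[R] V) := LinearMap.toSpanSingleton R _ a
  have hker : LinearMap.ker f = IsLocalRing.maximalIdeal R := by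
    ext r
    rw [LinearMap.mem_ker, LinearMap.toSpanSingleton_apply]
    constructor
    · intro h
      by_contra hr
      rw [IsLocalRing.notMem_maximalIdeal] at hr
      apply hv0
      have h1 : r • v = 0 := by
        rw [← ha]
        exact LinearMap.congr_fun h 1
      exact (hr.smul_eq_zero).mp h1
    · intro h
      refine hom_residueField_ext ?_
      rw [LinearMap.smul_apply, ha, hv r h, LinearMap.zero_apply]
  have hsurj : Function.Surjective f := by
    intro b
    obtain ⟨c, hc⟩ := hspan (b 1) fun r hr => by
      rw [← map_smul, smul_residueField_eq_zero hr, map_zero]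
    refine ⟨c, hom_residueField_ext ?_⟩
    rw [LinearMap.toSpanSingleton_apply, LinearMap.smul_apply, ha, hc]
  exact ⟨((Submodule.quotEquivOfEq _ _ hker).symm ≪≫ₗ f.quotKerEquivOfSurjective hsurj).symm⟩

variable {Q : Type u} [AddCommGroup Q] [Module R Q]

/-- `Ext¹(R/𝔪, C)` is the socle of `Q / C` for a submodule `C` of an injective module `Q` with
trivial socle. -/
theorem nonempty_ext_one_residueField_linearEquiv (hQ : Module.Injective R Q)
    (hT : ∀ a : IsLocalRing.ResidueField R →ₗ[R] Q, a = 0) (C : Submodule R Q) {q : Q}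
    (hq0 : q ∉ C) (hq : ∀ r ∈ IsLocalRing.maximalIdeal R, r • q ∈ C)
    (hspan : ∀ f : Q, (∀ r ∈ IsLocalRing.maximalIdeal R, r • f ∈ C) → ∃ c : R, f - c • q ∈ C) :
    Nonempty (Ext (ModuleCat.of R (IsLocalRing.ResidueField R)) (ModuleCat.of R C) 1 ≃ₗ[R]
      IsLocalRing.ResidueField R) := by
  obtain ⟨e⟩ := nonempty_ext_one_linearEquiv_hom_quotient hQ hT C.subtype C.injective_subtype
  rw [Submodule.range_subtype] at e
  have hmk : ∀ (r : R) (f : Q), r • (Submodule.Quotient.mk f : Q ⧸ C) = 0 ↔ r • f ∈ C :=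
    fun r f => by rw [← Submodule.Quotient.mk_smul, Submodule.Quotient.mk_eq_zero]
  obtain ⟨e'⟩ := nonempty_hom_residueField_linearEquiv (R := R)
    (v := (Submodule.Quotient.mk q : Q ⧸ C))
    (fun h => hq0 ((Submodule.Quotient.mk_eq_zero _).mp h))
    (fun r hr => (hmk r _).mpr (hq r hr))
    (fun w hw => by
      obtain ⟨f, rfl⟩ := Submodule.Quotient.mk_surjective _ w
      obtain ⟨c, hc⟩ := hspan f fun r hr => (hmk r f).mp (hw r hr)
      exact ⟨c, (Submodule.Quotient.eq _).mpr hc⟩)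
  exact ⟨e ≪≫ₗ e'⟩

/-- If `Ext¹(R/𝔪, I) ≅ R/𝔪`, then any two socle elements of `Q / I` are linearly dependent
over `R/𝔪`. -/
theorem exists_smul_sub_smul_mem_of_ext_one_equiv (hQ : Module.Injective R Q)
    (hT : ∀ a : IsLocalRing.ResidueField R →ₗ[R] Q, a = 0) {I : Submodule R Q} {C : Type u}
    [AddCommGroup C] [Module R C] (e₀ : I ≃ₗ[R] C)
    (e₁ : Ext (ModuleCat.of R (IsLocalRing.ResidueField R)) (ModuleCat.of R C) 1 ≃ₗ[R]
      IsLocalRing.ResidueField R) {p q : Q} (hp0 : p ∉ I)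
    (hp : ∀ r ∈ IsLocalRing.maximalIdeal R, r • p ∈ I)
    (hq : ∀ r ∈ IsLocalRing.maximalIdeal R, r • q ∈ I) :
    ∃ r s : R, r ∉ IsLocalRing.maximalIdeal R ∧ s • p - r • q ∈ I := by
  have hrange : LinearMap.range (I.subtype ∘ₗ e₀.symm.toLinearMap) = I := by
    rw [LinearMap.range_comp, LinearEquiv.range, Submodule.map_top, Submodule.range_subtype]
  obtain ⟨e₂⟩ := nonempty_ext_one_linearEquiv_hom_quotient hQ hT
    (I.subtype ∘ₗ e₀.symm.toLinearMap) (I.injective_subtype.comp e₀.symm.injective)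
  rw [hrange] at e₂
  have e := e₂.symm ≪≫ₗ e₁
  obtain ⟨a, ha⟩ := exists_hom_residueField_apply_one (v := (Submodule.Quotient.mk p : Q ⧸ I))
    fun r hr => (Submodule.Quotient.mk_eq_zero I).mpr (hp r hr)
  obtain ⟨b, hb⟩ := exists_hom_residueField_apply_one (v := (Submodule.Quotient.mk q : Q ⧸ I))
    fun r hr => (Submodule.Quotient.mk_eq_zero I).mpr (hq r hr)
  obtain ⟨r, hr⟩ := IsLocalRing.residue_surjective (e a)
  obtain ⟨s, hs⟩ := IsLocalRing.residue_surjective (e b)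
  have hrel : s • a - r • b = 0 := by
    apply e.injective
    rw [map_sub, map_smul, map_smul, map_zero, Algebra.smul_def, Algebra.smul_def,
      IsLocalRing.ResidueField.algebraMap_eq, hr, hs, mul_comm, sub_self]
  refine ⟨r, s, fun hr0 => hp0 ?_, ?_⟩
  · have hea : e a = 0 := by
      rw [← hr]
      exact (IsLocalRing.residue_eq_zero_iff r).mpr hr0
    have ha0 : a = 0 := e.injective (hea.trans (map_zero e).symm)
    rwa [ha0, LinearMap.zero_apply, eq_comm, Submodule.Quotient.mk_eq_zero] at ha
  · rw [← Submodule.Quotient.mk_eq_zero, Submodule.Quotient.mk_sub, Submodule.Quotient.mk_smul,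
      Submodule.Quotient.mk_smul, ← ha, ← hb]
    exact LinearMap.congr_fun hrel 1

end ResidueField

theorem hom_residueField_laurentSeries_eq_zero
    (a : IsLocalRing.ResidueField (ringR k) →ₗ[ringR k] k⸨X⸩) : a = 0 := by
  obtain ⟨r, hr, h9⟩ := exists_mem_maximalIdeal_algebraMap_eq_tpow (k := k) (n := 9)
    (by simp [mem_exponentSet]) (by simp)
  ext1 x
  have h : r • a x = 0 := by rw [← map_smul, smul_residueField_eq_zero hr, map_zero]
  refine (smul_eq_zero_iff_ringR.mp h).resolve_left ?_
  rintro rfl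
  rw [map_zero] at h9
  exact tpow_ne_zero 9 h9.symm

theorem forall_coeff_mul_tpow_ne_zero_iff {S : Set ℤ} {f : k⸨X⸩} {a : ℤ} :
    (∀ n, (f * tpow k a).coeff n ≠ 0 → n ∈ S) ↔ ∀ n, f.coeff n ≠ 0 → n + a ∈ S := by
  rw [mul_comm]
  exact support_tpow_mul_subset_iff

theorem smul_tpow_seventeen_mem_idealK {r : ringR k}
    (hr : r ∈ IsLocalRing.maximalIdeal (ringR k)) : r • tpow k 17 ∈ idealK k := by
  rw [mem_idealK_iff, Algebra.smul_def]
  refine forall_coeff_mul_tpow_ne_zero_iff.mpr fun n hn => ?_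
  have := mem_maximalIdeal_iff_orderGE.mp hr n hn
  change _ ∨ _
  omega

theorem tpow_notMem_idealK : tpow k 17 ∉ idealK k := fun h => by
  have := mem_idealK_iff.mp h 17 (by simp [tpow])
  omega

/-- The socle of `Q / K` is spanned by the class of `t^17`. -/
theorem exists_sub_smul_tpow_mem_idealK {f : k⸨X⸩}
    (hf : ∀ r ∈ IsLocalRing.maximalIdeal (ringR k), r • f ∈ idealK k) :
    ∃ c : ringR k, f - c • tpow k 17 ∈ idealK k := by
  obtain ⟨c, hc⟩ := exists_algebraMap_eq_single (k := k) (n := 0) (by simp [mem_exponentSet])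
    (f.coeff 17)
  refine ⟨c, mem_idealK_iff.mpr fun n hn => ?_⟩
  have hcoeff : (c • tpow k 17).coeff n = if n = 17 then f.coeff 17 else 0 := by
    rw [Algebra.smul_def, hc, coeff_single_mul', sub_zero, tpow]
    split_ifs with h
    · rw [h, HahnSeries.coeff_single_same, mul_one]
    · rw [HahnSeries.coeff_single_of_ne h, mul_zero]
  rw [HahnSeries.coeff_sub, hcoeff] at hn
  split_ifs at hn with h
  · exact absurd (by rw [h, sub_self]) hn
  · rw [sub_zero] at hn
    -- An exponent `n ∉ K` other than `17` is moved to `17` by some `t^h` with `0 ≠ h ∈ H`.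
    by_contra hK
    obtain ⟨r, hr, hrh⟩ := exists_mem_maximalIdeal_algebraMap_eq_tpow (k := k) (n := 17 - n)
      (by
        rw [mem_exponentSet]
        omega) (by omega)
    have := mem_idealK_iff.mp (hf r hr) 17 (by
      rwa [Algebra.smul_def, hrh, coeff_tpow_mul, sub_sub_cancel])
    omega

instance finite_monomialModule (s : Set ℕ) [Finite s] :
    Module.Finite (ringR k) (monomialModule k s) :=
  Module.Finite.iff_fg.mpr (Submodule.fg_span ((Set.toFinite s).image _))

instance nontrivial_monomialModule (s : Set ℕ) [Nonempty s] :
    Nontrivial (monomialModule k s) := by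
  obtain ⟨a, ha⟩ := ‹Nonempty s›
  refine nontrivial_of_ne (⟨_, Submodule.subset_span ⟨a, ha, rfl⟩⟩ : monomialModule k s) 0 ?_
  intro h
  have h' := congrArg Subtype.val h
  exact tpow_ne_zero (k := k) a ((coe_X_pow a).symm.trans h')

theorem isMaximalCohenMacaulay_monomialModule (s : Set ℕ) [Finite s] [Nonempty s] :
    IsMaximalCohenMacaulay (ringR k) (monomialModule k s) :=
  isMaximalCohenMacaulay_of_torsionFree _ fun _ _ h =>
    (smul_eq_zero_iff_ringR.mp (congrArg Subtype.val h)).imp_right Subtype.ext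

theorem isCanonicalModule_idealK : IsCanonicalModule (ringR k) (idealK k) where
  isNoetherianRing := inferInstance
  ring_cohenMacaulay := isMaximalCohenMacaulay_of_torsionFree _ fun _ _ h => mul_eq_zero.mp h
  maximalCohenMacaulay := isMaximalCohenMacaulay_monomialModule _
  finite_injectiveDimension := ⟨1, hasInjectiveDimensionLE_one_of_injective _
    injective_laurentSeries injective_quotient_idealK⟩
  type_eq_one d hd := by
    rw [ringKrullDim_ringR] at hd
    obtain rfl : d = 1 := by exact_mod_cast hd.symm
    exact nonempty_ext_one_residueField_linearEquiv injective_laurentSeries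
      hom_residueField_laurentSeries_eq_zero (idealK k) tpow_notMem_idealK
      (fun _ => smul_tpow_seventeen_mem_idealK) (fun _ => exists_sub_smul_tpow_mem_idealK)

/-- `I` is not a canonical module: its type is at least two, the socle of `Q / I` containing the
linearly independent classes of `t^14` and `t^17`. -/
theorem not_nonempty_idealI_equiv_canonical (C : Type u) [AddCommGroup C] [Module (ringR k) C]
    (hC : IsCanonicalModule (ringR k) C) : ¬ Nonempty (idealI k ≃ₗ[ringR k] C) := by
  rintro ⟨e₀⟩
  obtain ⟨e₁⟩ := hC.type_eq_one 1 ringKrullDim_ringR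
  have hsocle : ∀ n : ℤ, n = 14 ∨ n = 17 → ∀ r ∈ IsLocalRing.maximalIdeal (ringR k),
      r • tpow k n ∈ idealI k := by
    intro n hn r hr
    rw [mem_idealI_iff, Algebra.smul_def]
    refine forall_coeff_mul_tpow_ne_zero_iff.mpr fun m hm => ?_
    have h1 := mem_maximalIdeal_iff_orderGE.mp hr m hm
    change _ ∨ _
    omega
  have h14 : tpow k 14 ∉ idealI k := fun h => by
    have := mem_idealI_iff.mp h 14 (by simp [tpow])
    omega
  obtain ⟨r, s, hr, hmem⟩ := exists_smul_sub_smul_mem_of_ext_one_equiv injective_laurentSeries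
    hom_residueField_laurentSeries_eq_zero e₀ e₁ h14 (hsocle 14 (Or.inl rfl))
    (hsocle 17 (Or.inr rfl))
  rw [mem_maximalIdeal_iff_coeff_zero] at hr
  have hs3 : (algebraMap (ringR k) k⸨X⸩ s).coeff (17 - 14) = 0 := by
    by_contra h3
    have := mem_exponentSet.mp (support_algebraMap_subset s h3)
    omega
  have := mem_idealI_iff.mp hmem 17 (by
    rwa [HahnSeries.coeff_sub, Algebra.smul_def, Algebra.smul_def, mul_comm, coeff_tpow_mul,
      mul_comm (algebraMap _ _ r), coeff_tpow_mul, sub_self, hs3, zero_sub, neg_ne_zero])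
  omega

/-! ### Self-extensions of `(1, t)` -/

section SelfExtensions

variable {R : Type u} [CommRing R] {Q : Type u} [Field Q] [Algebra R Q]

theorem spanFinrank_le_one_of_equiv {I : Submodule R Q} (e : I ≃ₗ[R] R) :
    I.spanFinrank ≤ 1 := by
  have hI : I = Submodule.span R {(e.symm 1 : Q)} := by
    refine le_antisymm (fun x hx => ?_) ?_
    · refine Submodule.mem_span_singleton.mpr ⟨e ⟨x, hx⟩, ?_⟩
      rw [← Submodule.coe_smul, ← map_smul, smul_eq_mul, mul_one, e.symm_apply_apply]
    · rw [Submodule.span_singleton_le_iff_mem]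
      exact (e.symm 1).2
  have h := Submodule.spanFinrank_span_le_ncard_of_finite (R := R)
    (Set.finite_singleton (e.symm 1 : Q))
  rwa [← hI, Set.ncard_singleton] at h

variable [IsFractionRing R Q]

/-- Multiplication by `q ∈ Q` as a map `J → R`, when `q J ⊆ R`. -/
def mulToRing (J : Submodule R Q) (q : Q) (h : ∀ x ∈ J, ∃ r : R, algebraMap R Q r = q * x) :
    J →ₗ[R] R where
  toFun x := (h x x.2).choose
  map_add' x y := IsFractionRing.injective R Q (by
    rw [(h _ (x + y).2).choose_spec, map_add, (h _ x.2).choose_spec, (h _ y.2).choose_spec,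
      Submodule.coe_add, mul_add])
  map_smul' r x := IsFractionRing.injective R Q (by
    rw [(h _ (r • x).2).choose_spec, RingHom.id_apply, smul_eq_mul, map_mul,
      (h _ x.2).choose_spec, Submodule.coe_smul, Algebra.smul_def, mul_left_comm])

theorem algebraMap_mulToRing (J : Submodule R Q) (q : Q)
    (h : ∀ x ∈ J, ∃ r : R, algebraMap R Q r = q * x) (x : J) :
    algebraMap R Q (mulToRing J q h x) = q * x := (h x x.2).choose_spec

/-- A homomorphism between submodules of the fraction field is a multiplication. -/
theorem linearMap_apply_eq_mul {J I : Submodule R Q} (a : J →ₗ[R] I) {y : Q} (hy : y ∈ J)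
    (hy0 : y ≠ 0) (x : J) : (a x : Q) = a ⟨y, hy⟩ * y⁻¹ * x := by
  obtain ⟨⟨r, s⟩, hx⟩ := IsLocalization.surj (nonZeroDivisors R) (x : Q)
  obtain ⟨⟨r', s'⟩, hy'⟩ := IsLocalization.surj (nonZeroDivisors R) y
  have hs : algebraMap R Q s ≠ 0 := IsLocalization.map_units Q s |>.ne_zero
  have hs' : algebraMap R Q s' ≠ 0 := IsLocalization.map_units Q s' |>.ne_zero
  have h : (s * r' : R) • a x = (r * s' : R) • a ⟨y, hy⟩ := by
    rw [← map_smul, ← map_smul]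
    congr 1
    ext
    change (s * r' : R) • (x : Q) = (r * s' : R) • y
    rw [Algebra.smul_def, Algebra.smul_def, map_mul, map_mul, ← hx, ← hy']
    ring
  have h' := congrArg Subtype.val h
  rw [Submodule.coe_smul, Submodule.coe_smul, Algebra.smul_def, Algebra.smul_def, map_mul, map_mul,
    ← hx, ← hy'] at h'
  rw [mul_right_comm, eq_mul_inv_iff_mul_eq₀ hy0]
  refine mul_left_cancel₀ (mul_ne_zero hs hs') ?_
  linear_combination h'

theorem bijective_lsmul_of_colon {I : Submodule R Q} (h1 : (1 : Q) ∈ I)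
    (hcolon : ∀ q : Q, (∀ x ∈ I, q * x ∈ I) → ∃ r : R, algebraMap R Q r = q) :
    Function.Bijective (LinearMap.lsmul R I : R →ₗ[R] (I →ₗ[R] I)) := by
  constructor
  · intro r s h
    have h' := congrArg Subtype.val (LinearMap.congr_fun h ⟨1, h1⟩)
    change r • (1 : Q) = s • (1 : Q) at h'
    rw [Algebra.smul_def, Algebra.smul_def, mul_one, mul_one] at h'
    exact IsFractionRing.injective R Q h'
  · intro a
    have ha : ∀ x : I, (a x : Q) = a ⟨1, h1⟩ * x := fun x => by
      rw [linearMap_apply_eq_mul a h1 one_ne_zero x, inv_one, mul_one]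
    obtain ⟨r, hr⟩ := hcolon (a ⟨1, h1⟩) fun x hx => by
      rw [← ha ⟨x, hx⟩]
      exact (a ⟨x, hx⟩).2
    refine ⟨r, LinearMap.ext fun x => Subtype.ext ?_⟩
    rw [ha, ← hr, ← Algebra.smul_def]
    rfl

/-- Let `I = (1, t)`, and let `J = {x ∈ R | t x ∈ R}` be its first syzygy. Suppose that
`J = u (1, t, t²)`, that `t² c ∈ I` implies `t c ∈ R` for `c ∈ R` (`hsyz`), and that
`I : J = (1, t, t²)` (`hcolon`). By `hsyz`, in a relation `a + b t + c t² = 0` the elements `c` and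
`b + t c` lie in `J`, so that the first syzygy of `J` is `J ⊕ J`. By `hcolon`, every homomorphism
from a first syzygy of `I` or `J` to `I` extends to the free module, so that
`Ext¹(I, I) = Ext¹(J, I) = 0`. The syzygy `J ⊕ J` then propagates the vanishing to all degrees. -/
theorem subsingleton_ext_of_syzygy {I J : Submodule R Q} {t u : Q} (hu : u ≠ 0)
    (hI : ∀ x, x ∈ I ↔ ∃ a b : R, x = algebraMap R Q a + algebraMap R Q b * t)
    (hJ : ∀ x, x ∈ J ↔ ∃ a b c : R,
      x = u * (algebraMap R Q a + algebraMap R Q b * t + algebraMap R Q c * t ^ 2))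
    (hJ' : ∀ x, x ∈ J ↔ (∃ r : R, algebraMap R Q r = x) ∧ ∃ r : R, algebraMap R Q r = t * x)
    (hsyz : ∀ c : R, t ^ 2 * algebraMap R Q c ∈ I →
      ∃ r : R, algebraMap R Q r = t * algebraMap R Q c)
    (hcolon : ∀ q : Q, (∀ x ∈ J, q * x ∈ I) → ∃ a b c : R,
      q = algebraMap R Q a + algebraMap R Q b * t + algebraMap R Q c * t ^ 2) (n : ℕ) :
    Subsingleton (Ext (ModuleCat.of R I) (ModuleCat.of R I) (n + 1)) := by
  have hinj := IsFractionRing.injective R Q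
  have hmemI : ∀ a b : R, algebraMap R Q a + algebraMap R Q b * t ∈ I :=
    fun a b => (hI _).mpr ⟨a, b, rfl⟩
  have hmemJ : ∀ a b c : R,
      u * (algebraMap R Q a + algebraMap R Q b * t + algebraMap R Q c * t ^ 2) ∈ J :=
    fun a b c => (hJ _).mpr ⟨a, b, c, rfl⟩
  have huJ : u ∈ J := by simpa using hmemJ 1 0 0
  -- Homomorphisms `J → I` are multiplications by elements of `(1, t, t²)`.
  have hhom : ∀ a : J →ₗ[R] I, ∃ p₀ p₁ p₂ : R, ∀ x : J, (a x : Q) =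
      (algebraMap R Q p₀ + algebraMap R Q p₁ * t + algebraMap R Q p₂ * t ^ 2) * x := by
    intro a
    have hq := linearMap_apply_eq_mul a huJ hu
    obtain ⟨p₀, p₁, p₂, hp⟩ := hcolon (a ⟨u, huJ⟩ * u⁻¹) fun x hx => by
      rw [← hq ⟨x, hx⟩]
      exact (a ⟨x, hx⟩).2
    exact ⟨p₀, p₁, p₂, fun x => by rw [hq, hp]⟩
  -- `ι x = x` and `τ x = t x` as maps `J → R`.
  let ι : J →ₗ[R] R := mulToRing J 1 fun x hx => by simpa using ((hJ' x).mp hx).1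
  have hι : ∀ x : J, algebraMap R Q (ι x) = x := fun x => by
    rw [algebraMap_mulToRing, one_mul]
  let τ : J →ₗ[R] R := mulToRing J t fun x hx => ((hJ' x).mp hx).2
  have hτ : ∀ x : J, algebraMap R Q (τ x) = t * x := fun x => algebraMap_mulToRing _ _ _ x
  -- The sequence `0 → J → R² → I → 0`, `x ↦ (-t x, x)`.
  let f₁ : J →ₗ[R] R × R := (-τ).prod ι
  let g₁ : R × R →ₗ[R] I := (LinearMap.toSpanSingleton R I ⟨1, by simpa using hmemI 1 0⟩).coprod
    (LinearMap.toSpanSingleton R I ⟨t, by simpa using hmemI 0 1⟩)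
  have hg₁ : ∀ p : R × R, (g₁ p : Q) = algebraMap R Q p.1 + algebraMap R Q p.2 * t := fun p => by
    change p.1 • (1 : Q) + p.2 • t = _
    rw [Algebra.smul_def, Algebra.smul_def, mul_one]
  have hf₁_inj : Function.Injective f₁ := fun x y h => by
    have := congrArg (fun p => algebraMap R Q (Prod.snd p)) h
    exact Subtype.ext ((hι x).symm.trans (this.trans (hι y)))
  have hex₁ : Function.Exact f₁ g₁ := by
    rintro ⟨a, b⟩
    rw [← Subtype.coe_inj, hg₁]
    constructor
    · intro h
      have hbt : t * algebraMap R Q b = algebraMap R Q (-a) := by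
        have h' : algebraMap R Q a + algebraMap R Q b * t = 0 := h
        rw [map_neg]
        linear_combination h'
      have hb : algebraMap R Q b ∈ J := (hJ' _).mpr ⟨⟨b, rfl⟩, ⟨-a, hbt.symm⟩⟩
      refine ⟨⟨_, hb⟩, Prod.ext (hinj ?_) (hinj (hι _))⟩
      change algebraMap R Q (-τ _) = _
      rw [map_neg, hτ, hbt, map_neg, neg_neg]
    · rintro ⟨x, hx⟩
      obtain ⟨rfl, rfl⟩ := Prod.ext_iff.mp hx
      change algebraMap R Q (-τ x) + algebraMap R Q (ι x) * t = 0
      rw [map_neg, hτ, hι]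
      ring
  have hg₁_surj : Function.Surjective g₁ := by
    rintro ⟨x, hx⟩
    obtain ⟨a, b, rfl⟩ := (hI x).mp hx
    exact ⟨(a, b), Subtype.ext (hg₁ _)⟩
  -- The sequence `0 → J² → R³ → J → 0`, `(x, y) ↦ (-t x, x - t y, y)`.
  let f₂ : J × J →ₗ[R] R × R × R := ((-τ) ∘ₗ LinearMap.fst R J J).prod
    ((ι ∘ₗ LinearMap.fst R J J - τ ∘ₗ LinearMap.snd R J J).prod (ι ∘ₗ LinearMap.snd R J J))
  have hf₂ : ∀ p, f₂ p = (-τ p.1, ι p.1 - τ p.2, ι p.2) := fun _ => rfl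
  let g₂ : R × R × R →ₗ[R] J :=
    (LinearMap.toSpanSingleton R J ⟨u, huJ⟩).coprod
      ((LinearMap.toSpanSingleton R J ⟨u * t, by simpa using hmemJ 0 1 0⟩).coprod
        (LinearMap.toSpanSingleton R J ⟨u * t ^ 2, by simpa using hmemJ 0 0 1⟩))
  have hg₂ : ∀ p : R × R × R, (g₂ p : Q) = u * (algebraMap R Q p.1 +
      algebraMap R Q p.2.1 * t + algebraMap R Q p.2.2 * t ^ 2) := fun p => by
    change p.1 • u + (p.2.1 • (u * t) + p.2.2 • (u * t ^ 2)) = _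
    simp only [Algebra.smul_def]
    ring
  have hf₂_inj : Function.Injective f₂ := by
    rintro ⟨x, y⟩ ⟨x', y'⟩ h
    rw [hf₂, hf₂, Prod.mk.injEq, Prod.mk.injEq] at h
    obtain ⟨-, h1, h2⟩ := h
    have hy : y = y' := Subtype.ext (by rw [← hι y, ← hι y']; exact congrArg _ h2)
    dsimp only at h1
    rw [hy, sub_left_inj] at h1
    have hx : x = x' := Subtype.ext (by rw [← hι x, ← hι x']; exact congrArg _ h1)
    rw [hx, hy]
  have hex₂ : Function.Exact f₂ g₂ := by
    rintro ⟨a, b, c⟩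
    rw [← Subtype.coe_inj, hg₂]
    constructor
    · intro h
      have h0 := (mul_eq_zero.mp h).resolve_left hu
      dsimp only at h0
      have hc : algebraMap R Q c ∈ J := (hJ' _).mpr ⟨⟨c, rfl⟩, hsyz c ((hI _).mpr ⟨-a, -b, by
        rw [map_neg, map_neg]
        linear_combination h0⟩)⟩
      have hb : algebraMap R Q b + t * algebraMap R Q c ∈ J :=
        (hJ' _).mpr ⟨⟨b + τ ⟨_, hc⟩, by rw [map_add, hτ]⟩, ⟨-a, by
          rw [map_neg]
          linear_combination -h0⟩⟩
      refine ⟨(⟨_, hb⟩, ⟨_, hc⟩), ?_⟩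
      rw [hf₂]
      refine Prod.ext (hinj ?_) (Prod.ext (hinj ?_) (hinj (hι _)))
      · rw [map_neg, hτ]
        linear_combination -h0
      · dsimp only
        rw [map_sub, hι, hτ]
        ring
    · rintro ⟨⟨x, y⟩, hxy⟩
      rw [hf₂, Prod.mk.injEq, Prod.mk.injEq] at hxy
      obtain ⟨rfl, rfl, rfl⟩ := hxy
      simp only [map_neg, map_sub, hτ, hι, ZeroMemClass.coe_zero]
      ring
  have hg₂_surj : Function.Surjective g₂ := by
    rintro ⟨x, hx⟩
    obtain ⟨a, b, c, rfl⟩ := (hJ x).mp hx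
    exact ⟨(a, b, c), Subtype.ext (hg₂ _)⟩
  have hJI : ∀ m : ℕ, Subsingleton (Ext (ModuleCat.of R J) (ModuleCat.of R I) (m + 1)) := by
    intro m
    induction m with
    | zero =>
      refine subsingleton_ext_one_of_forall_exists_extension hf₂_inj hex₂ hg₂_surj fun a => ?_
      obtain ⟨p₀, p₁, p₂, hp⟩ := hhom (a ∘ₗ LinearMap.inl R J J)
      obtain ⟨q₀, q₁, q₂, hq⟩ := hhom (a ∘ₗ LinearMap.inr R J J)
      -- With `p, q ∈ (1, t, t²)` the multipliers, solve `y - t x = p` and `z - t y = q` in `I`.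
      let b : R × R × R →ₗ[R] I :=
        (LinearMap.toSpanSingleton R I ⟨_, hmemI (-q₂ - p₁) (-p₂)⟩).coprod
          ((LinearMap.toSpanSingleton R I ⟨_, hmemI p₀ (-q₂)⟩).coprod
            (LinearMap.toSpanSingleton R I ⟨_, hmemI q₀ (q₁ + p₀)⟩))
      have hb : ∀ w : R × R × R, (b w : Q) =
          algebraMap R Q w.1 * (algebraMap R Q (-q₂ - p₁) + algebraMap R Q (-p₂) * t) +
          (algebraMap R Q w.2.1 * (algebraMap R Q p₀ + algebraMap R Q (-q₂) * t) +
          algebraMap R Q w.2.2 * (algebraMap R Q q₀ + algebraMap R Q (q₁ + p₀) * t)) := fun w => by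
        simp only [← Algebra.smul_def (_ : R) (_ + _ : Q)]
        rfl
      refine ⟨b, LinearMap.ext fun ⟨x, y⟩ => Subtype.ext ?_⟩
      have hxy : (a (x, y) : Q) = a (x, 0) + a (0, y) := by
        rw [← Submodule.coe_add, ← map_add, Prod.mk_add_mk, add_zero, zero_add]
      rw [LinearMap.comp_apply, hb, hf₂, hxy]
      refine Eq.trans ?_ (congrArg₂ (· + ·) (hp x) (hq y)).symm
      simp only [map_neg, map_sub, map_add, hτ, hι]
      ring
    | succ m ih =>
      exact subsingleton_ext_succ_of_kernel hf₂_inj hex₂ hg₂_surj m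
        (subsingleton_ext_prod (m + 1) ih ih)
  cases n with
  | zero =>
    refine subsingleton_ext_one_of_forall_exists_extension hf₁_inj hex₁ hg₁_surj fun a => ?_
    obtain ⟨p₀, p₁, p₂, hp⟩ := hhom a
    -- With `p ∈ (1, t, t²)` the multiplier, solve `y - t x = p` in `I`.
    let b : R × R →ₗ[R] I := (LinearMap.toSpanSingleton R I ⟨_, hmemI (-p₁) (-p₂)⟩).coprod
      (LinearMap.toSpanSingleton R I ⟨_, hmemI p₀ 0⟩)
    have hb : ∀ w : R × R, (b w : Q) =
        algebraMap R Q w.1 * (algebraMap R Q (-p₁) + algebraMap R Q (-p₂) * t) +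
        algebraMap R Q w.2 * (algebraMap R Q p₀ + algebraMap R Q 0 * t) := fun w => by
      simp only [← Algebra.smul_def (_ : R) (_ + _ : Q)]
      rfl
    refine ⟨b, LinearMap.ext fun x => Subtype.ext ?_⟩
    rw [LinearMap.comp_apply, hb, hp]
    change algebraMap R Q (-τ x) * _ + algebraMap R Q (ι x) * _ = _
    simp only [map_neg, map_zero, hτ, hι]
    ring
  | succ n => exact subsingleton_ext_succ_of_kernel hf₁_inj hex₁ hg₁_surj n (hJI n)

end SelfExtensions

theorem mem_idealI_iff_exists {x : k⸨X⸩} : x ∈ idealI k ↔ ∃ a b : ringR k,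
    x = algebraMap (ringR k) k⸨X⸩ a + algebraMap (ringR k) k⸨X⸩ b * tpow k 1 := by
  have hI : idealI k = Submodule.span (ringR k) {(1 : k⸨X⸩), tpow k 1} := by
    rw [idealI, monomialModule, Set.image_pair, coe_X_pow, coe_X_pow]
    rfl
  rw [hI, Submodule.mem_span_pair]
  simp only [Algebra.smul_def, mul_one, eq_comm]

theorem mem_span_zero_one_two_iff_exists {x : k⸨X⸩} :
    x ∈ monomialModule k {0, 1, 2} ↔ ∃ a b c : ringR k, x = algebraMap (ringR k) k⸨X⸩ a +
      algebraMap (ringR k) k⸨X⸩ b * tpow k 1 + algebraMap (ringR k) k⸨X⸩ c * tpow k 1 ^ 2 := by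
  have h2 : tpow k 1 ^ 2 = tpow k 2 := by rw [sq, ← tpow_add]; rfl
  have hI : monomialModule k {0, 1, 2} =
      Submodule.span (ringR k) {(1 : k⸨X⸩), tpow k 1, tpow k 2} := by
    rw [monomialModule, Set.image_insert_eq, Set.image_pair, coe_X_pow, coe_X_pow, coe_X_pow]
    rfl
  rw [hI, Submodule.mem_span_triple, h2]
  simp only [Algebra.smul_def, mul_one, eq_comm]

theorem subsingleton_ext_idealI (n : ℕ) :
    Subsingleton (Ext (ModuleCat.of (ringR k) (idealI k)) (ModuleCat.of (ringR k) (idealI k))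
      (n + 1)) := by
  have h2 : tpow k 1 ^ 2 = tpow k 2 := by rw [sq, ← tpow_add]; rfl
  refine subsingleton_ext_of_syzygy (J := idealJ k) (t := tpow k 1) (u := tpow k 9)
    (tpow_ne_zero 9) (fun _ => mem_idealI_iff_exists) ?_ ?_ ?_ ?_ n
  · intro x
    have hx : x ∈ idealJ k ↔ tpow k (-9) * x ∈ monomialModule k {0, 1, 2} := by
      rw [mem_idealJ_iff, mem_monomialModule_zero_one_two_iff]
      constructor
      · intro h m hm
        rw [coeff_tpow_mul] at hm
        have := h _ hm
        omega
      · intro h m hm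
        have := h (m - 9) (by rwa [coeff_tpow_mul, sub_neg_eq_add, sub_add_cancel])
        omega
    have h9 : ∀ y : k⸨X⸩, tpow k (-9) * x = y ↔ x = tpow k 9 * y := fun y => by
      have h1 : tpow k 9 * tpow k (-9) = 1 := by rw [← tpow_add]; rfl
      constructor
      · rintro rfl
        rw [← mul_assoc, h1, one_mul]
      · rintro rfl
        rw [← mul_assoc, mul_comm (tpow k (-9)), h1, one_mul]
    simp only [hx, mem_span_zero_one_two_iff_exists, h9]
  · intro x
    rw [exists_algebraMap_eq_iff, exists_algebraMap_eq_iff, support_tpow_mul_subset_iff,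
      mem_idealJ_iff]
    constructor
    · intro h
      refine ⟨fun m hm => ?_, fun m hm => ?_⟩
      all_goals
        have := h m hm
        rw [mem_exponentSet]
        omega
    · rintro ⟨h0, h1⟩ m hm
      have h0 := mem_exponentSet.mp (h0 hm)
      have h1 := mem_exponentSet.mp (h1 m hm)
      omega
  · intro c hc
    rw [h2, mem_idealI_iff] at hc
    refine exists_algebraMap_eq_iff.mpr (support_tpow_mul_subset_iff.mpr fun m hm => ?_)
    have h0 := mem_exponentSet.mp (support_algebraMap_subset c hm)
    have h1 := hc (m + 2) (by rwa [coeff_tpow_mul, add_sub_cancel_right])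
    rw [mem_exponentSet]
    omega
  · intro q hq
    rw [← mem_span_zero_one_two_iff_exists, mem_monomialModule_zero_one_two_iff]
    have hq' : ∀ a : ℤ, 9 ≤ a ∧ a ≤ 11 → q * tpow k a ∈ idealI k := fun a ha => hq _ (by
      rw [mem_idealJ_iff]
      intro m hm
      have : m = a := by
        by_contra h
        exact hm (HahnSeries.coeff_single_of_ne h)
      omega)
    intro m hm
    have h := fun a ha => mem_idealI_iff.mp (hq' a ha) (m + a)
      (by rwa [mul_comm, coeff_tpow_mul, add_sub_cancel_right])
    have h9 := h 9 (by norm_num)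
    have h10 := h 10 (by norm_num)
    have h11 := h 11 (by norm_num)
    omega

theorem bijective_lsmul_idealI : Function.Bijective
    (LinearMap.lsmul (ringR k) (idealI k) :
      ringR k →ₗ[ringR k] (idealI k →ₗ[ringR k] idealI k)) := by
  have h1 : (1 : k⸨X⸩) ∈ idealI k := mem_idealI_iff_exists.mpr ⟨1, 0, by simp⟩
  have ht : tpow k 1 ∈ idealI k := mem_idealI_iff_exists.mpr ⟨0, 1, by simp⟩
  refine bijective_lsmul_of_colon h1 fun q hq => exists_algebraMap_eq_iff.mpr fun n hn => ?_
  -- Both `n` and `n + 1` are exponents of `I`.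
  have hq0 := mem_idealI_iff.mp (hq 1 h1) n (by rwa [mul_one])
  have hq1 := mem_idealI_iff.mp (hq _ ht) (n + 1)
    (by rwa [mul_comm, coeff_tpow_mul, add_sub_cancel_right])
  rw [mem_exponentSet]
  omega

theorem isSemidualizing_idealI : IsSemidualizing (ringR k) (idealI k) where
  finite := inferInstance
  homothety_bijective := bijective_lsmul_idealI
  ext_eq_zero i hi := by
    obtain ⟨n, rfl⟩ := Nat.exists_eq_succ_of_ne_zero hi.ne'
    exact subsingleton_ext_idealI n

theorem spanFinrank_idealI : (idealI k).spanFinrank = 2 := by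
  have := spanFinrank_monomialModule (k := k) {0, 1} (by
    simp [mem_exponentSet])
  simpa using this

theorem spanFinrank_idealK : (idealK k).spanFinrank = 4 := by
  have := spanFinrank_monomialModule (k := k) {0, 1, 3, 4} (by
    simp [mem_exponentSet])
  simpa using this

theorem spanFinrank_idealK_div_idealI : (idealK k / idealI k).spanFinrank = 2 := by
  have := spanFinrank_monomialModule (k := k) {0, 3} (by
    simp [mem_exponentSet])
  rw [idealK_div_idealI]
  simpa using this

theorem not_nonempty_idealI_equiv_ring : ¬ Nonempty (idealI k ≃ₗ[ringR k] ringR k) := by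
  rintro ⟨e⟩
  have := spanFinrank_le_one_of_equiv e
  rw [spanFinrank_idealI] at this
  omega

end

theorem mainTheorem6 (k : Type u) [Field k] :
    -- `I` and `K` are fractional ideals of `R`, and `K` is a canonical module of `R`
    IsFractional (nonZeroDivisors (ringR k)) (idealI k) ∧
    IsFractional (nonZeroDivisors (ringR k)) (idealK k) ∧
    IsCanonicalModule (ringR k) (idealK k) ∧
    -- `K : I = (1, t^3)`, and the minimal numbers of generators of `I`, `K : I` and `K`
    idealK k / idealI k = monomialModule k {0, 3} ∧
    (idealI k).spanFinrank = 2 ∧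
    (idealK k / idealI k).spanFinrank = 2 ∧
    (idealK k).spanFinrank = 4 ∧
    -- `I` is a nontrivial semidualizing module of `R`
    IsNontrivialSemidualizing (ringR k) (idealI k) ∧
    -- `e(R) = 9`
    HasMultiplicity (ringR k) 9 := by
  refine ⟨by simpa using isFractional_monomialModule (k := k) {0, 1},
    by simpa using isFractional_monomialModule (k := k) {0, 1, 3, 4}, isCanonicalModule_idealK,
    idealK_div_idealI, spanFinrank_idealI, spanFinrank_idealK_div_idealI, spanFinrank_idealK,
    ⟨isSemidualizing_idealI, not_nonempty_idealI_equiv_ring,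
      fun C _ _ hC => not_nonempty_idealI_equiv_canonical C hC⟩, hasMultiplicity_ringR⟩
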